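/- A \emph{continuum} is a nonempty compact connected metrizable space. A \emph{simple closed curve} in a space is a subspace homeomorphic to a circle. A \emph{dendrite} is a locally connected continuum containing no simple closed curve, and a \emph{local dendrite} is a continuum in which every point has a neighborhood that is a dendrite. The \emph{core skeleton} of a local dendrite $X$ is $\emptyset$ if $X$ contains no simple closed curve, and otherwise the smallest subcontinuum of $X$ containing all simple closed curves of $X$. Let $\mathscr{P}$ be the category of pointed dendrites $(D,P)$ (with $D$ a dendrite and $P\in D$), whose morphisms are the topological embeddings that preserve the distinguished point. Let $G$ be a local dendrite. A \emph{$G$-dendrite} is a local dendrite $X$ with an embedding $G\hookrightarrow X$ (used to identify $G$ with its image) such that $G$ contains the core skeleton of $X$. Let $\mathscr{D}_G$ be the category of $G$-dendrites, whose morphisms are the topological embeddings $X \to Y$ that restrict to the identity on $G$. \textbf{Theorem.} Each $G$-dendrite $X$ has a continuous retraction $r_X\colon X\to G$ (necessarily unique) that maps each connected component $C$ of $X\setminus G$ to the point $g \in G$ with $\overline{C}\cap G=\{g\}$. For each $g\in G$, the fiber $X_g:=r_X^{-1}(g)$ is a dendrite, which we point at $g$. Every morphism $f\colon X\to Y$ of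 $G$-dendrites satisfies $r_Y\circ f=r_X$, so it restricts to morphisms $X_g\to Y_g$ in $\mathscr{P}$. The resulting functor \[ F\colon \mathscr{D}_G\longrightarrow\prod_{g\in G}\mathscr{P},\qquad X\longmapsto (X_g)_{g\in G}, \] is fully faithful, and its essential image consists of the tuples $(D_g)_{g\in G}$ of pointed dendrites such that $\{g\in G : \#D_g>1\}$ is countable. -/

import Mathlib

open CategoryTheory Topology

universe u

/-- A continuum: a compact connected metrizable space (in particular, nonempty). -/
structure IsContinuum (X : Type u) [TopologicalSpace X] : Prop where
  compact : CompactSpace X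
  connected : ConnectedSpace X
  metrizable : TopologicalSpace.MetrizableSpace X

/-- A simple closed curve in a space: a subspace homeomorphic to a circle. -/
def IsSimpleClosedCurve {X : Type u} [TopologicalSpace X] (S : Set X) : Prop :=
  Nonempty (S ≃ₜ Circle)

/-- A dendrite: a locally connected continuum containing no simple closed curve. -/
structure IsDendrite (X : Type u) [TopologicalSpace X] : Prop where
  continuum : IsContinuum X
  locallyConnected : LocallyConnectedSpace X
  noCurve : ∀ S : Set X, ¬ IsSimpleClosedCurve S

/-- A local dendrite: a continuum in which every point has a neighborhood that is a dendrite. -/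
structure IsLocalDendrite (X : Type u) [TopologicalSpace X] : Prop where
  continuum : IsContinuum X
  exists_nhds : ∀ x : X, ∃ N ∈ 𝓝 x, IsDendrite N

/-- The core skeleton of a local dendrite: empty if there is no simple closed curve, and otherwise
the smallest subcontinuum containing all the simple closed curves, written as the intersection of
all subcontinua containing them. -/
def coreSkeleton (X : Type u) [TopologicalSpace X] : Set X :=
  {x | (∃ S : Set X, IsSimpleClosedCurve S) ∧
    ∀ K : Set X, IsContinuum K → (∀ S : Set X, IsSimpleClosedCurve S → S ⊆ K) → x ∈ K}

/-- A pointed dendrite. -/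
structure PointedDendrite : Type (u + 1) where
  carrier : Type u
  [top : TopologicalSpace carrier]
  isDendrite : IsDendrite carrier
  point : carrier

namespace PointedDendrite

instance : CoeSort PointedDendrite.{u} (Type u) := ⟨PointedDendrite.carrier⟩

instance (P : PointedDendrite.{u}) : TopologicalSpace P := P.top

/-- An embedding of pointed dendrites. -/
@[ext]
structure Hom (P Q : PointedDendrite.{u}) : Type u where
  toFun : P → Q
  isEmbedding : IsEmbedding toFun
  map_point : toFun P.point = Q.point

/-- The category of pointed dendrites and embeddings. -/
instance : Category.{u} PointedDendrite.{u} where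
  Hom := Hom
  id P := ⟨id, IsEmbedding.id, rfl⟩
  comp f g := ⟨g.toFun ∘ f.toFun, g.isEmbedding.comp f.isEmbedding, by
    rw [Function.comp_apply, f.map_point, g.map_point]⟩

end PointedDendrite

/-- A `G`-dendrite: a local dendrite with an embedding of `G` whose image contains the core
skeleton. -/
structure GDendrite (G : Type u) [TopologicalSpace G] : Type (u + 1) where
  carrier : Type u
  [top : TopologicalSpace carrier]
  isLocalDendrite : IsLocalDendrite carrier
  incl : G → carrier
  isEmbedding : IsEmbedding incl
  coreSkeleton_subset : coreSkeleton carrier ⊆ Set.range incl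

namespace GDendrite

variable {G : Type u} [TopologicalSpace G]

instance : CoeSort (GDendrite G) (Type u) := ⟨GDendrite.carrier⟩

instance (X : GDendrite G) : TopologicalSpace X := X.top

/-- A morphism of `G`-dendrites: an embedding extending the identity of `G`. -/
@[ext]
structure Hom (X Y : GDendrite G) : Type u where
  toFun : X → Y
  isEmbedding : IsEmbedding toFun
  map_incl : ∀ g : G, toFun (X.incl g) = Y.incl g

/-- The category of `G`-dendrites. -/
instance : Category.{u} (GDendrite G) where
  Hom := Hom
  id X := ⟨id, IsEmbedding.id, fun _ => rfl⟩
  comp f h := ⟨h.toFun ∘ f.toFun, h.isEmbedding.comp f.isEmbedding, fun g => by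
    rw [Function.comp_apply, f.map_incl, h.map_incl]⟩

/-- The property characterizing the canonical retraction `r : X → G`: it is continuous, restricts
to the identity on `G`, and for each connected component `C` of `X - G` it maps `C` to a point
`g` of `G` such that the closure of `C` meets `G` exactly in `g`. -/
structure IsCanonicalRetraction (X : GDendrite G) (r : X → G) : Prop where
  continuous : Continuous r
  map_incl : ∀ g : G, r (X.incl g) = g
  closure_inter : ∀ x : X, x ∉ Set.range X.incl →
    closure (connectedComponentIn (Set.range X.incl)ᶜ x) ∩ Set.range X.incl = {X.incl (r x)}

/-- The functor sending a `G`-dendrite `X` to the tuple of the fibers `r ⁻¹ g`, pointed at `g`, and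
a morphism to the tuple of its restrictions to the fibers, for retractions `r` whose fibers are
dendrites and with which the morphisms are compatible. -/
def fiberFunctor (r : ∀ X : GDendrite G, X → G) (hr : ∀ X : GDendrite G, X.IsCanonicalRetraction (r X))
    (hD : ∀ (X : GDendrite G) (g : G), IsDendrite {x : X // r X x = g})
    (hM : ∀ (X Y : GDendrite G) (f : X ⟶ Y) (x : X), r Y (Hom.toFun f x) = r X x) :
    GDendrite G ⥤ (∀ _ : G, PointedDendrite.{u}) where
  obj X g :=
    { carrier := {x : X // r X x = g}
      isDendrite := hD X g
      point := ⟨X.incl g, (hr X).map_incl g⟩ }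
  map {X Y} f g :=
    { toFun := fun x => ⟨Hom.toFun f x.1, (hM X Y f x.1).trans x.2⟩
      isEmbedding := (f.isEmbedding.comp IsEmbedding.subtypeVal).codRestrict
        {y : Y | r Y y = g} (fun x => (hM X Y f x.1).trans x.2)
      map_point := Subtype.ext (f.map_incl g) }
  map_id _ := rfl
  map_comp _ _ := rfl

end GDendrite

/-! The hypothesis on the core skeleton is used in one form only: every simple closed curve of `X`
lies in `G`. The main point is that the closure of a component `C` of `X \ G` meets `G` in exactly
one point. It meets `G` because otherwise `C` would be clopen in the connected space `X`. If it met
`G` in two points, an arc through `C` could be cut down to an arc meeting `G` only in its endpoints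
and closed up by an arc inside `G`, giving a simple closed curve not contained in `G`
(`exists_isSimpleClosedCurve_not_subset`). This needs arcs in locally connected continua, which are
built here from scratch: paths as limits of refined chains, then arcs from paths by erasing loops.

Sending `C` to its limit point defines the retraction, whose continuity at `G` follows from local
connectedness. Each fiber without its base point is a union of components, hence open. This gives
that fibers are dendrites and that only countably many are nondegenerate, since disjoint nonempty
open sets in a separable space are countable in number.

A morphism maps components into components, so it commutes with the retractions and is determined on
fibers. Conversely, embeddings of fibers glue, because in a compact space fibers over points near
`g` but different from `g` shrink to `g` (`isEmbedding_of_fibers`). A tuple with countably many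
nondegenerate members is realized inside the product of `G` and those members (`AttachedSpace`),
where countability gives metrizability. -/

/-! ### Paths in complete locally connected spaces. -/

section PathConstruction

open Set Filter

/-- A sequence of points whose consecutive terms lie in connected open sets of diameter at
most `ε`. -/
structure IsConnectedChain {X : Type*} [PseudoMetricSpace X] (ε : ℝ) (z : ℕ → X)
    (W : ℕ → Set X) : Prop where
  isOpen : ∀ j, IsOpen (W j)
  isPreconnected : ∀ j, IsPreconnected (W j)
  left_mem : ∀ j, z j ∈ W j
  right_mem : ∀ j, z (j + 1) ∈ W j
  dist_le : ∀ j, ∀ u ∈ W j, ∀ v ∈ W j, dist u v ≤ ε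

variable {X : Type*} [PseudoMetricSpace X] [LocallyConnectedSpace X]

theorem exists_isOpen_isPreconnected_dist_le {V : Set X} (hV : IsOpen V) {x : X} (hx : x ∈ V)
    {ε : ℝ} (hε : 0 < ε) :
    ∃ W ⊆ V, IsOpen W ∧ IsPreconnected W ∧ x ∈ W ∧ ∀ u ∈ W, ∀ v ∈ W, dist u v ≤ ε := by
  obtain ⟨W, hW, hWo, hxW, hWc⟩ := locallyConnectedSpace_iff_subsets_isOpen_isConnected.1
    ‹LocallyConnectedSpace X› x (V ∩ Metric.ball x (ε / 2))
    (inter_mem (hV.mem_nhds hx) (Metric.ball_mem_nhds x (half_pos hε)))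
  refine ⟨W, hW.trans inter_subset_left, hWo, hWc.isPreconnected, hxW, fun u hu v hv => ?_⟩
  have h1 : dist u x < ε / 2 := (hW hu).2
  have h2 : dist v x < ε / 2 := (hW hv).2
  linarith [dist_triangle_right u v x]

theorem exists_isConnectedChain_const {V : Set X} (hV : IsOpen V) {x : X} (hx : x ∈ V)
    {ε : ℝ} (hε : 0 < ε) :
    ∃ W : ℕ → Set X, IsConnectedChain ε (fun _ => x) W ∧ ∀ j, W j ⊆ V := by
  obtain ⟨W, hWV, hWo, hWc, hxW, hd⟩ := exists_isOpen_isPreconnected_dist_le hV hx hε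
  exact ⟨fun _ => W, ⟨fun _ => hWo, fun _ => hWc, fun _ => hxW, fun _ => hxW, fun _ => hd⟩,
    fun _ => hWV⟩

/-- Being joined by finitely many small links inside `V` is an equivalence relation with open
classes, so on a connected `V` there is one class. Finite chains are encoded as sequences that are
eventually constant. -/
theorem exists_isConnectedChain {V : Set X} (hV : IsOpen V) (hVc : IsPreconnected V) {x y : X}
    (hx : x ∈ V) (hy : y ∈ V) {ε : ℝ} (hε : 0 < ε) :
    ∃ (n : ℕ) (z : ℕ → X) (W : ℕ → Set X), IsConnectedChain ε z W ∧ z 0 = x ∧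
      (∀ j ≥ n, z j = y) ∧ ∀ j, W j ⊆ V := by
  let link : X → X → Prop := fun a b => ∃ W ⊆ V, IsOpen W ∧ IsPreconnected W ∧ a ∈ W ∧ b ∈ W ∧
    ∀ u ∈ W, ∀ v ∈ W, dist u v ≤ ε
  have key : Relation.ReflTransGen link x y := by
    refine hVc.induction₂ (Relation.ReflTransGen link) (fun a ha => ?_)
      (fun a b c _ _ _ h1 h2 => h1.trans h2) (fun a b _ _ h => ?_) hx hy
    · obtain ⟨W, hWV, hWo, hWc, haW, hd⟩ := exists_isOpen_isPreconnected_dist_le hV ha hε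
      filter_upwards [mem_nhdsWithin_of_mem_nhds (hWo.mem_nhds haW)] with b hb
      exact .single ⟨W, hWV, hWo, hWc, haW, hb, hd⟩
    · have : Std.Symm link :=
        ⟨fun a b ⟨W, h1, h2, h3, h4, h5, h6⟩ => ⟨W, h1, h2, h3, h5, h4, h6⟩⟩
      exact Std.Symm.symm (r := Relation.ReflTransGen link) _ _ h
  induction key using Relation.ReflTransGen.head_induction_on with
  | refl =>
    obtain ⟨W, hW, hWV⟩ := exists_isConnectedChain_const hV hy hε
    exact ⟨0, _, W, hW, rfl, fun _ _ => rfl, hWV⟩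
  | head h h' ih =>
    rename_i a b
    clear h'
    obtain ⟨U, hUV, hUo, hUc, haU, hbU, hUd⟩ := h
    obtain ⟨n, z, W, hW, hz0, hzn, hWV⟩ := ih (hUV hbU)
    refine ⟨n + 1, fun j => Nat.casesOn j a z, fun j => Nat.casesOn j U W,
      ⟨?_, ?_, ?_, ?_, ?_⟩, rfl, ?_, ?_⟩
    · rintro (_ | j); exacts [hUo, hW.isOpen j]
    · rintro (_ | j); exacts [hUc, hW.isPreconnected j]
    · rintro (_ | j); exacts [haU, hW.left_mem j]
    · rintro (_ | j); exacts [show z 0 ∈ U from hz0.symm ▸ hbU, hW.right_mem j]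
    · rintro (_ | j); exacts [hUd, hW.dist_le j]
    · rintro (_ | j) hj; exacts [absurd hj (by simp), hzn j (by omega)]
    · rintro (_ | j); exacts [hUV, hWV j]

/-- Each link is open and connected, so its two marked points are joined by a finer chain inside it.
Padding all these chains to a common length `k` makes the `j`th fine link lie in the coarse link `j
/ k`. -/
theorem IsConnectedChain.exists_refinement {ε : ℝ} {z : ℕ → X} {W : ℕ → Set X}
    (h : IsConnectedChain ε z W) {N : ℕ} {y : X} (hN : ∀ j ≥ N, z j = y) {δ : ℝ} (hδ : 0 < δ) :
    ∃ (k : ℕ) (z' : ℕ → X) (W' : ℕ → Set X), 0 < k ∧ IsConnectedChain δ z' W' ∧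
      (∀ j, z' (j * k) = z j) ∧ (∀ j, W' j ⊆ W (j / k)) ∧ ∀ j ≥ N * k, z' j = y := by
  have key : ∀ j, ∃ (n : ℕ) (zz : ℕ → X) (WW : ℕ → Set X), IsConnectedChain δ zz WW ∧
      zz 0 = z j ∧ (∀ i ≥ n, zz i = z (j + 1)) ∧ (∀ i, WW i ⊆ W j) ∧ (N ≤ j → n = 0) := by
    intro j
    by_cases hj : N ≤ j
    · obtain ⟨WW, h1, h2⟩ := exists_isConnectedChain_const (h.isOpen j) (h.left_mem j) hδ
      exact ⟨0, _, WW, h1, rfl, fun i _ => (hN j hj).trans (hN (j + 1) (by omega)).symm, h2,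
        fun _ => rfl⟩
    · obtain ⟨n, zz, WW, h1, h2, h3, h4⟩ := exists_isConnectedChain (h.isOpen j)
        (h.isPreconnected j) (h.left_mem j) (h.right_mem j) hδ
      exact ⟨n, zz, WW, h1, h2, h3, h4, fun h' => absurd h' hj⟩
  choose n zz WW hc h0 hn hsub hzero using key
  -- Only the links before `N` need subdivision, so a maximum exists; adding one keeps `k` positive.
  let k := (Finset.range N).sup n + 1
  have hk : 0 < k := Nat.succ_pos _
  have hnk : ∀ j, n j ≤ k := fun j => by
    by_cases hj : N ≤ j
    · rw [hzero j hj]; exact hk.le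
    · exact (Finset.le_sup (f := n) (Finset.mem_range.2 (not_le.1 hj))).trans (Nat.le_succ _)
  have hmul : ∀ j, zz (j * k / k) (j * k % k) = z j := fun j => by
    rw [Nat.mul_div_cancel _ hk, Nat.mul_mod_left, h0]
  refine ⟨k, fun m => zz (m / k) (m % k), fun m => WW (m / k) (m % k), hk,
    ⟨fun m => (hc _).isOpen _, fun m => (hc _).isPreconnected _, fun m => (hc _).left_mem _,
      fun m => ?_, fun m => (hc _).dist_le _⟩, hmul, fun m => hsub _ _, fun m hm => ?_⟩
  · have hlt := Nat.mod_lt m hk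
    have hdm := Nat.div_add_mod m k
    have h1 := (hc (m / k)).right_mem (m % k)
    by_cases hlast : m % k + 1 < k
    · have e1 : (m + 1) / k = m / k := by
        rw [← hdm, add_assoc, Nat.mul_add_div hk, Nat.div_eq_of_lt hlast, add_zero,
          Nat.mul_add_div hk, Nat.div_eq_of_lt hlt, add_zero]
      have e2 : (m + 1) % k = m % k + 1 := by
        rw [Nat.add_mod, Nat.mod_eq_of_lt (a := 1) (by omega), Nat.mod_eq_of_lt hlast]
      simpa only [e1, e2] using h1
    -- At the end of a block the padded chain has reached its endpoint, which is where the next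
    -- block starts.
    · have e : m + 1 = (m / k + 1) * k := by nlinarith
      have h2 : m % k + 1 = k := by omega
      rw [h2, hn _ _ (hnk _), ← hmul, ← e] at h1
      exact h1
  · have hle : N ≤ m / k := (Nat.le_div_iff_mul_le hk).2 hm
    simp only
    rw [hn _ _ (by rw [hzero _ hle]; exact Nat.zero_le _), hN _ (by omega)]

/-- Iterated refinement puts time `t` at level `n` in the link numbered `⌊t * N n⌋₊`. These links
are nested with diameters at most `2⁻ⁿ`, so the marked points converge, uniformly in `t`. In a
pseudometric space the endpoints are attained only up to distance zero. -/
theorem exists_continuous_of_isPreconnected [CompleteSpace X] {V : Set X} (hV : IsOpen V)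
    (hVc : IsPreconnected V) {x y : X} (hx : x ∈ V) (hy : y ∈ V) :
    ∃ f : ℝ → X, Continuous f ∧ dist (f 0) x = 0 ∧ dist (f 1) y = 0 ∧ ∀ t, f t ∈ closure V := by
  let S : ℕ → Type _ := fun n => {s : ℕ × (ℕ → X) × (ℕ → Set X) //
    0 < s.1 ∧ IsConnectedChain ((1 / 2 : ℝ) ^ n) s.2.1 s.2.2 ∧ s.2.1 0 = x ∧
      (∀ j ≥ s.1, s.2.1 j = y) ∧ ∀ j, s.2.2 j ⊆ V}
  have hstep : ∀ n (s : S n), ∃ s' : S (n + 1), ∃ k, 0 < k ∧ s'.1.1 = s.1.1 * k ∧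
      ∀ j, s'.1.2.2 j ⊆ s.1.2.2 (j / k) := by
    rintro n ⟨⟨N, z, W⟩, hN, hc, h0, hz, hsub⟩
    obtain ⟨k, z', W', hk, hc', hz', hW', hy'⟩ :=
      hc.exists_refinement hz (pow_pos one_half_pos (n + 1))
    refine ⟨⟨⟨N * k, z', W'⟩, Nat.mul_pos hN hk, hc', ?_, hy', fun j => (hW' j).trans (hsub _)⟩,
      k, hk, rfl, hW'⟩
    have := hz' 0
    rw [zero_mul] at this
    exact this.trans h0
  have hS0 : Nonempty (S 0) := by
    obtain ⟨n, z, W, hc, h0, hz, hsub⟩ := exists_isConnectedChain hV hVc hx hy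
      (pow_pos (one_half_pos (α := ℝ)) 0)
    exact ⟨⟨⟨n + 1, z, W⟩, Nat.succ_pos _, hc, h0, fun j hj => hz j (by simp at hj; omega),
      hsub⟩⟩
  choose next k hk hNk hWk using hstep
  let s : ∀ n, S n := fun n => Nat.rec (Classical.choice hS0) next n
  have hs : ∀ n, s (n + 1) = next n (s n) := fun n => rfl
  let N : ℕ → ℕ := fun n => (s n).1.1
  let z : ℕ → ℕ → X := fun n => (s n).1.2.1
  let W : ℕ → ℕ → Set X := fun n => (s n).1.2.2
  have hNpos : ∀ n, 0 < N n := fun n => (s n).2.1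
  have hc : ∀ n, IsConnectedChain ((1 / 2 : ℝ) ^ n) (z n) (W n) := fun n => (s n).2.2.1
  let B : ℝ → ℕ → Set X := fun t n => W n ⌊t * N n⌋₊
  have hB : ∀ t, Antitone (B t) := fun t => by
    refine antitone_nat_of_succ_le fun n => ?_
    have h1 : N (n + 1) = N n * k n (s n) := hNk n (s n)
    have h2 : ⌊t * N n⌋₊ = ⌊t * N (n + 1)⌋₊ / k n (s n) := by
      rw [← Nat.floor_div_natCast, h1, Nat.cast_mul, ← mul_assoc, mul_div_cancel_right₀]
      exact_mod_cast (hk n (s n)).ne'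
    change W (n + 1) _ ⊆ W n _
    rw [h2]
    exact hWk n (s n) _
  let F : ℕ → ℝ → X := fun n t => z n ⌊t * N n⌋₊
  have hFB : ∀ t n m, n ≤ m → F m t ∈ B t n := fun t n m h => hB t h ((hc m).left_mem _)
  have hpow : Tendsto (fun n : ℕ => (1 / 2 : ℝ) ^ n) atTop (𝓝 0) :=
    tendsto_pow_atTop_nhds_zero_of_lt_one (by norm_num) (by norm_num)
  have hcau : ∀ t, CauchySeq fun n => F n t := fun t =>
    cauchySeq_of_le_tendsto_0 (fun n => (1 / 2 : ℝ) ^ n)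
      (fun n m p hn hm => (hc p).dist_le _ _ (hFB t p n hn) _ (hFB t p m hm)) hpow
  choose f hf using fun t => cauchySeq_tendsto_of_complete (hcau t)
  have hdist : ∀ t n, dist (f t) (F n t) ≤ (1 / 2 : ℝ) ^ n := fun t n =>
    le_of_tendsto ((hf t).dist tendsto_const_nhds) (eventually_atTop.2
      ⟨n, fun m hm => (hc n).dist_le _ _ (hFB t n m hm) _ (hFB t n n le_rfl)⟩)
  have hend : ∀ t a, (∀ n, F n t = a) → dist (f t) a = 0 := fun t a h => by
    refine le_antisymm ?_ dist_nonneg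
    exact ge_of_tendsto' hpow fun n => by simpa [h n] using hdist t n
  refine ⟨f, ?_, hend 0 x fun n => ?_, hend 1 y fun n => ?_, fun t => ?_⟩
  · rw [Metric.continuous_iff]
    intro t ε hε
    obtain ⟨n, hn⟩ := ((tendsto_order.1 hpow).2 (ε / 3) (by positivity)).exists
    have hNn : (0 : ℝ) < N n := by exact_mod_cast hNpos n
    -- Consecutive marked points share a link, so parameters closer than `1 / N n` give level `n`
    -- values within `2⁻ⁿ`, although the level `n` map is a step function.
    have hstep : ∀ i j : ℕ, i ≤ j + 1 → j ≤ i + 1 → dist (z n i) (z n j) ≤ (1 / 2 : ℝ) ^ n := by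
      intro i j h1 h2
      obtain rfl | rfl | rfl : i = j ∨ i = j + 1 ∨ j = i + 1 := by omega
      · simp
      · exact (hc n).dist_le _ _ ((hc n).right_mem _) _ ((hc n).left_mem _)
      · exact (hc n).dist_le _ _ ((hc n).left_mem _) _ ((hc n).right_mem _)
    have hfloor : ∀ a b : ℝ, a < b + 1 → ⌊a⌋₊ ≤ ⌊b⌋₊ + 1 := fun a b hab => by
      rcases le_total 0 b with hb | hb
      · rw [← Nat.floor_add_one hb]
        exact Nat.floor_mono hab.le
      · rw [Nat.floor_eq_zero.2 (show a < 1 by linarith)]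
        exact Nat.zero_le _
    refine ⟨1 / N n, by positivity, fun r hr => ?_⟩
    rw [Real.dist_eq, lt_div_iff₀ hNn] at hr
    have h1 : |r * N n - t * N n| < 1 := by
      rwa [← sub_mul, abs_mul, abs_of_pos hNn]
    rw [abs_lt] at h1
    have h2 : dist (F n r) (F n t) ≤ (1 / 2 : ℝ) ^ n :=
      hstep _ _ (hfloor _ _ (by linarith)) (hfloor _ _ (by linarith))
    have h3 := hdist r n
    have h4 := hdist t n
    rw [dist_comm] at h4
    linarith [dist_triangle4 (f r) (F n r) (F n t) (f t)]
  · change z n _ = x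
    rw [zero_mul, Nat.floor_zero]
    exact (s n).2.2.2.1
  · change z n _ = y
    rw [one_mul, Nat.floor_natCast]
    exact (s n).2.2.2.2.1 _ le_rfl
  · exact mem_closure_of_tendsto (hf t) (Eventually.of_forall fun n =>
      (s n).2.2.2.2.2 _ ((hc n).left_mem _))

end PathConstruction

/-- A locally connected complete metric space is locally path connected. -/
theorem locallyPathConnectedSpace_of_completeSpace (X : Type*) [MetricSpace X] [CompleteSpace X]
    [LocallyConnectedSpace X] : LocallyPathConnectedSpace X := by
  rw [locallyPathConnectedSpace_iff_pathComponentIn_mem_nhds]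
  intro x U hU hxU
  obtain ⟨K, hK, hKc, hKU⟩ := exists_mem_nhds_isClosed_subset (hU.mem_nhds hxU)
  obtain ⟨V, hVK, hVo, hxV, hVc⟩ := locallyConnectedSpace_iff_subsets_isOpen_isConnected.1
    ‹LocallyConnectedSpace X› x K hK
  refine Filter.mem_of_superset (hVo.mem_nhds hxV) fun y hy => ?_
  obtain ⟨f, hf, h0, h1, hV⟩ := exists_continuous_of_isPreconnected hVo hVc.isPreconnected hxV hy
  rw [dist_eq_zero] at h0 h1
  exact JoinedIn.ofLine hf.continuousOn h0 h1 fun y ⟨t, _, ht⟩ =>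
    hKU (closure_minimal hVK hKc (ht ▸ hV t))

/-! ### From paths to arcs, and from arcs to simple closed curves. -/

section Arcs

open Set Filter unitInterval

/-- A continuous map on the unit interval with order-connected fibers factors through an
injective one with the same endpoints and the same range. -/
theorem exists_injective_of_monotone_fibers {X : Type*} [MetricSpace X] {g : I → X}
    (hg : Continuous g) (hfib : ∀ s u t, s ≤ u → u ≤ t → g s = g t → g u = g s)
    (h01 : g 0 ≠ g 1) :
    ∃ γ : C(I, X), Function.Injective γ ∧ γ 0 = g 0 ∧ γ 1 = g 1 ∧ range γ ⊆ range g := by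
  -- For `p ≤ t` this is the largest distance from `g p` to `g u` with `u` in `[p, t]`, and for `t ≤
  -- p` it is zero. Clamping `s` keeps the supremum over a fixed compact set, which gives continuity
  -- in `t`.
  let h : I → I → ℝ := fun p t => sSup ((fun s => dist (g p) (g (max p (min s t)))) '' univ)
  have hbdd : ∀ p t, BddAbove ((fun s => dist (g p) (g (max p (min s t)))) '' univ) := fun p t =>
    (isCompact_univ.image (by fun_prop)).bddAbove
  have hcont : ∀ p, Continuous (h p) := fun p =>
    isCompact_univ.continuous_sSup (f := fun t s => dist (g p) (g (max p (min s t))))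
      (by fun_prop)
  have hmono : ∀ p, Monotone (h p) := fun p t t' htt => by
    refine csSup_le_csSup (hbdd p t') ⟨_, mem_image_of_mem _ (mem_univ 0)⟩ ?_
    rintro _ ⟨s, -, rfl⟩
    refine ⟨min s t, mem_univ _, ?_⟩
    simp only [min_assoc, min_eq_left htt]
  have hconst : ∀ p t t', t ≤ t' → g t = g t' → h p t = h p t' := fun p t t' htt heq => by
    have hin : ∀ u ∈ Icc t t', ∀ v ∈ Icc t t', g u = g v := fun u hu v hv =>
      (hfib t u t' hu.1 hu.2 heq).trans (hfib t v t' hv.1 hv.2 heq).symm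
    have : (fun s => dist (g p) (g (max p (min s t)))) =
        fun s => dist (g p) (g (max p (min s t'))) := by
      funext s
      congr 1
      rcases le_total s t with hs | hs
      · rw [min_eq_left hs, min_eq_left (hs.trans htt)]
      · rw [min_eq_right hs]
        have hu : min s t' ∈ Icc t t' := ⟨le_min hs htt, min_le_right _ _⟩
        rcases le_total p t with hp | hp
        · rw [max_eq_right hp, max_eq_right (hp.trans hu.1)]
          exact hin _ ⟨le_rfl, htt⟩ _ hu
        · rw [max_eq_left hp]
          rcases le_total p (min s t') with hp' | hp'
          · rw [max_eq_right hp']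
            exact hin _ ⟨hp, hp'.trans hu.2⟩ _ hu
          · rw [max_eq_left hp']
    simp only [h, this]
  have hzero : ∀ p t, t ≤ p → h p t = 0 := fun p t htp => by
    have : (fun s => dist (g p) (g (max p (min s t)))) = fun _ => 0 := by
      funext s
      rw [max_eq_left ((min_le_right s t).trans htp), dist_self]
    simp only [h, this, univ_nonempty.image_const, csSup_singleton]
  have hpos : ∀ p t, p ≤ t → g p ≠ g t → 0 < h p t := fun p t hpt hne =>
    (dist_pos.2 hne).trans_le (le_csSup (hbdd p t) ⟨t, mem_univ _, by
      simp only [min_self, max_eq_right hpt]⟩)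
  obtain ⟨D, hD⟩ := (isCompact_univ.image (f := fun q : I × I => dist (g q.1) (g q.2))
    (by fun_prop)).bddAbove
  have hD' : ∀ u v, dist (g u) (g v) ≤ D := fun u v => hD ⟨(u, v), mem_univ _, rfl⟩
  have hnn : ∀ p t, 0 ≤ h p t := fun p t =>
    Real.sSup_nonneg (by rintro _ ⟨s, -, rfl⟩; exact dist_nonneg)
  have hle : ∀ p t, h p t ≤ D := fun p t =>
    csSup_le ⟨_, mem_image_of_mem _ (mem_univ 0)⟩ (by rintro _ ⟨s, -, rfl⟩; exact hD' _ _)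
  let q : ℕ → I := TopologicalSpace.denseSeq I
  -- Summing over a dense set of base points gives a monotone function with exactly the same fibers
  -- as `g`.
  let φ : I → ℝ := fun t => ∑' n, (1 / 2 : ℝ) ^ n * h (q n) t
  have hbound : ∀ n t, ‖(1 / 2 : ℝ) ^ n * h (q n) t‖ ≤ (1 / 2 : ℝ) ^ n * D := fun n t => by
    rw [Real.norm_of_nonneg (mul_nonneg (by positivity) (hnn _ _))]
    exact mul_le_mul_of_nonneg_left (hle _ _) (by positivity)
  have hsumD : Summable fun n : ℕ => (1 / 2 : ℝ) ^ n * D := summable_geometric_two.mul_right D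
  have hsum : ∀ t, Summable fun n => (1 / 2 : ℝ) ^ n * h (q n) t := fun t =>
    hsumD.of_norm_bounded fun n => hbound n t
  have hφc : Continuous φ :=
    continuous_tsum (fun n => continuous_const.mul (hcont (q n))) hsumD hbound
  have hφlt : ∀ s t, s < t → g s ≠ g t → φ s < φ t := fun s t hst hne => by
    obtain ⟨u, ⟨hsu, hut⟩, hu⟩ : ∃ u ∈ Ioo s t, g u ≠ g t := by
      have h1 : ∀ᶠ u in 𝓝[>] s, g u ≠ g t :=
        (hg.continuousAt.eventually_ne hne).filter_mono nhdsWithin_le_nhds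
      have h2 : ∀ᶠ u in 𝓝[>] s, u ∈ Ioo s t := Ioo_mem_nhdsGT hst
      have : (𝓝[>] s).NeBot := nhdsGT_neBot_of_exists_gt ⟨t, hst⟩
      obtain ⟨u, hu1, hu2⟩ := (h1.and h2).exists
      exact ⟨u, hu2, hu1⟩
    -- For a base point strictly between `s` and `t` with a value other than `g t`, the term
    -- vanishes at `s` and is positive at `t`.
    obtain ⟨n, hn1, hn2⟩ := (TopologicalSpace.denseRange_denseSeq I).exists_mem_open
      (s := Ioo s t ∩ {u | g u ≠ g t})
      (isOpen_Ioo.inter (isOpen_ne_fun hg continuous_const)) ⟨u, ⟨hsu, hut⟩, hu⟩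
    refine (hsum s).tsum_lt_tsum (i := n) (fun m => ?_) ?_ (hsum t)
    · exact mul_le_mul_of_nonneg_left (hmono _ hst.le) (by positivity)
    · refine mul_lt_mul_of_pos_left ?_ (by positivity)
      change h (q n) s < h (q n) t
      rw [hzero (q n) s hn1.1.le]
      exact hpos _ _ hn1.2.le hn2
  have hφeq' : ∀ s t, s ≤ t → g s = g t → φ s = φ t := fun s t hst heq =>
    tsum_congr fun n => by rw [hconst (q n) s t hst heq]
  have hφ : ∀ s t, φ s = φ t ↔ g s = g t := fun s t => by
    constructor
    · intro h
      by_contra hne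
      rcases lt_trichotomy s t with hst | rfl | hst
      · exact (hφlt s t hst hne).ne h
      · exact hne rfl
      · exact (hφlt t s hst (Ne.symm hne)).ne h.symm
    · intro h
      rcases le_total s t with hst | hst
      · exact hφeq' s t hst h
      · exact (hφeq' t s hst h.symm).symm
  have hφmono : Monotone φ := fun s t hst =>
    (hsum s).tsum_le_tsum (fun n => mul_le_mul_of_nonneg_left (hmono _ hst) (by positivity))
      (hsum t)
  have hpos' : 0 < φ 1 - φ 0 := sub_pos.2 (hφlt 0 1 zero_lt_one h01)
  let ψ : C(I, I) := ⟨fun t => ⟨(φ t - φ 0) / (φ 1 - φ 0),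
    div_nonneg (sub_nonneg.2 (hφmono nonneg')) hpos'.le,
    (div_le_one hpos').2 (sub_le_sub_right (hφmono le_one') _)⟩, by fun_prop⟩
  have hψ0 : ψ 0 = 0 := Subtype.ext (by simp [ψ])
  have hψ1 : ψ 1 = 1 := Subtype.ext (by simp [ψ, div_self hpos'.ne'])
  have hψ : ∀ s t, ψ s = ψ t ↔ g s = g t := fun s t => by
    rw [← hφ, Subtype.ext_iff]
    simp only [ψ, ContinuousMap.coe_mk, div_left_inj' hpos'.ne', sub_left_inj]
  have hsurj : Function.Surjective ψ := fun v => by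
    obtain ⟨t, -, ht⟩ := intermediate_value_Icc (zero_le_one (α := I)) ψ.continuous.continuousOn
      (show v ∈ Icc (ψ 0) (ψ 1) by rw [hψ0, hψ1]; exact ⟨nonneg', le_one'⟩)
    exact ⟨t, ht⟩
  -- The normalized `φ` is a quotient map of the interval onto itself, and `g` descends along it to
  -- an injective map.
  have hq : IsQuotientMap ψ := .of_surjective_continuous hsurj ψ.continuous
  let γ : C(I, X) := hq.lift ⟨g, hg⟩ fun s t hst => (hψ s t).1 hst
  have hγ : ∀ t, γ (ψ t) = g t := fun t =>
    DFunLike.congr_fun (hq.lift_comp ⟨g, hg⟩ fun s t hst => (hψ s t).1 hst) t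
  refine ⟨γ, fun a b hab => ?_, ?_, ?_, ?_⟩
  · obtain ⟨s, rfl⟩ := hsurj a
    obtain ⟨t, rfl⟩ := hsurj b
    rw [hγ, hγ] at hab
    exact (hψ s t).2 hab
  · simpa only [hψ0] using hγ 0
  · simpa only [hψ1] using hγ 1
  · rintro _ ⟨a, rfl⟩
    obtain ⟨s, rfl⟩ := hsurj a
    exact ⟨s, (hγ s).symm⟩

/-- The closed sets containing the endpoints of the unit interval such that a given map takes
equal values at the two endpoints of each complementary interval. -/
def loopErasures {X : Type*} (f : I → X) : Set (Set I) :=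
  {A | IsClosed A ∧ 0 ∈ A ∧ 1 ∈ A ∧ ∀ a ∈ A, ∀ b ∈ A, a < b → Ioo a b ∩ A = ∅ → f a = f b}

/-- Zorn's lemma applied to intersections of chains. If a gap `(a, b)` of the intersection had `f a
≠ f b`, compactness would give a member of the chain missing `[a', b']`, with `a'` near `a` and `b'`
near `b`. The endpoints of its gap around `[a', b']` have equal values in disjoint neighborhoods of
`f a` and `f b`. -/
theorem exists_minimal_loopErasures {X : Type*} [TopologicalSpace X] [T2Space X] {f : I → X}
    (hf : Continuous f) : ∃ A, Minimal (· ∈ loopErasures f) A := by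
  have huniv : univ ∈ loopErasures f := by
    refine ⟨isClosed_univ, mem_univ _, mem_univ _, fun a _ b _ hab h => ?_⟩
    rw [inter_univ] at h
    exact absurd h (nonempty_Ioo.2 hab).ne_empty
  suffices H : ∀ c ⊆ loopErasures f, IsChain (· ⊆ ·) c → c.Nonempty →
      ∃ lb ∈ loopErasures f, ∀ s ∈ c, lb ⊆ s by
    obtain ⟨A, -, hA⟩ := zorn_superset_nonempty (loopErasures f) H univ huniv
    exact ⟨A, hA⟩
  intro c hc hchain hne
  refine ⟨⋂₀ c, ⟨isClosed_sInter fun s hs => (hc hs).1, fun s hs => (hc hs).2.1,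
    fun s hs => (hc hs).2.2.1, fun a ha b hb hab hgap => ?_⟩, fun s hs => sInter_subset_of_mem hs⟩
  by_contra hfab
  obtain ⟨U, V, hU, hV, haU, hbV, hUV⟩ := t2_separation hfab
  obtain ⟨a', ⟨haa', ha'b⟩, hUa⟩ : ∃ a' ∈ Ioo a b, Icc a a' ⊆ f ⁻¹' U := by
    obtain ⟨w, hw, hwU⟩ := exists_Ico_subset_of_mem_nhds
      ((hU.preimage hf).mem_nhds haU) ⟨b, hab⟩
    obtain ⟨a', h1, h2⟩ := exists_between (lt_min hw hab)
    exact ⟨a', ⟨h1, h2.trans_le (min_le_right _ _)⟩, fun x hx =>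
      hwU ⟨hx.1, hx.2.trans_lt (h2.trans_le (min_le_left _ _))⟩⟩
  obtain ⟨b', ⟨ha'b', hb'b⟩, hVb⟩ : ∃ b' ∈ Ioo a' b, Icc b' b ⊆ f ⁻¹' V := by
    obtain ⟨w, hw, hwV⟩ := exists_Ioc_subset_of_mem_nhds
      ((hV.preimage hf).mem_nhds hbV) ⟨a, hab⟩
    obtain ⟨b', h1, h2⟩ := exists_between (max_lt hw ha'b)
    exact ⟨b', ⟨(le_max_right _ _).trans_lt h1, h2⟩, fun x hx =>
      hwV ⟨((le_max_left _ _).trans_lt h1).trans_le hx.1, hx.2⟩⟩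
  obtain ⟨s, hs, hsgap⟩ : ∃ s ∈ c, Icc a' b' ∩ s = ∅ := by
    have : Nonempty c := hne.to_subtype
    have hdir : Directed (· ⊇ ·) (fun s : c => (s : Set I)) := fun s t => by
      rcases hchain.total s.2 t.2 with h | h
      · exact ⟨s, subset_rfl, h⟩
      · exact ⟨t, h, subset_rfl⟩
    obtain ⟨s, hs⟩ := isCompact_Icc.elim_directed_family_closed
      (fun s : c => (s : Set I)) (fun s => (hc s.2).1) (s := Icc a' b') (by
        rw [← sInter_eq_iInter, ← subset_empty_iff, ← hgap]
        exact inter_subset_inter_left _ (Icc_subset_Ioo haa' hb'b)) hdir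
    exact ⟨s, s.2, hs⟩
  have hsc := hc hs
  obtain ⟨u, ⟨hus, hau, hua'⟩, humax⟩ := ((hsc.1.inter isClosed_Icc).isCompact
    (s := s ∩ Icc a a')).exists_isGreatest ⟨a, ha s hs, le_rfl, haa'.le⟩
  obtain ⟨v, ⟨hvs, hbv, hvb⟩, hvmin⟩ := ((hsc.1.inter isClosed_Icc).isCompact
    (s := s ∩ Icc b' b)).exists_isLeast ⟨b, hb s hs, hb'b.le, le_rfl⟩
  have huv : f u = f v := by
    refine hsc.2.2.2 u hus v hvs (hua'.trans_lt (ha'b'.trans_le hbv)) ?_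
    refine eq_empty_of_forall_notMem fun x ⟨⟨hux, hxv⟩, hxs⟩ => ?_
    rcases le_total x a' with hx | hx
    · exact (humax ⟨hxs, hau.trans hux.le, hx⟩).not_gt hux
    · rcases le_total x b' with hx' | hx'
      · exact (hsgap ▸ (⟨⟨hx, hx'⟩, hxs⟩ : x ∈ Icc a' b' ∩ s) : x ∈ (∅ : Set I)).elim
      · exact (hvmin ⟨hxs, hx', hxv.le.trans hvb⟩).not_gt hxv
  exact disjoint_left.1 hUV (hUa ⟨hau, hua'⟩) (huv ▸ hVb ⟨hbv, hvb⟩)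

/-- A path can be replaced, inside its range, by one with order-connected fibers. -/
theorem exists_monotone_fibers {X : Type*} [MetricSpace X] {f : I → X} (hf : Continuous f) :
    ∃ g : I → X, Continuous g ∧ (∀ s u t, s ≤ u → u ≤ t → g s = g t → g u = g s) ∧
      g 0 = f 0 ∧ g 1 = f 1 ∧ range g ⊆ range f := by
  obtain ⟨A, ⟨hAc, h0, h1, hgap⟩, hmin⟩ := exists_minimal_loopErasures hf
  have hlo : ∀ t, ∃ s, IsGreatest (A ∩ Iic t) s := fun t =>
    ((hAc.inter isClosed_Iic).isCompact (s := A ∩ Iic t)).exists_isGreatest ⟨0, h0, nonneg'⟩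
  have hhi : ∀ t, ∃ s, IsLeast (A ∩ Ici t) s := fun t =>
    ((hAc.inter isClosed_Ici).isCompact (s := A ∩ Ici t)).exists_isLeast ⟨1, h1, le_one'⟩
  -- The nearest points of `A` on either side of `t`. The map `f ∘ lo` freezes `f` on every gap of
  -- `A`.
  choose lo hlo using hlo
  choose hi hhi using hhi
  have hloA : ∀ t, lo t ∈ A := fun t => (hlo t).1.1
  have hlole : ∀ t, lo t ≤ t := fun t => (hlo t).1.2
  have hlomono : Monotone lo := fun s t hst => (hlo t).2 ⟨hloA s, (hlole s).trans hst⟩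
  have hloid : ∀ t ∈ A, lo t = t := fun t ht => (hlole t).antisymm ((hlo t).2 ⟨ht, le_refl t⟩)
  have hlohi : ∀ t, f (hi t) = f (lo t) := fun t => by
    rcases ((hlole t).trans (hhi t).1.2).eq_or_lt with h | h
    · rw [h]
    · refine (hgap _ (hloA t) _ (hhi t).1.1 h ?_).symm
      refine eq_empty_of_forall_notMem fun x ⟨⟨hx1, hx2⟩, hxA⟩ => ?_
      rcases le_total x t with hx | hx
      · exact ((hlo t).2 ⟨hxA, hx⟩).not_gt hx1
      · exact ((hhi t).2 ⟨hxA, hx⟩).not_gt hx2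
  -- Two points of `A` with the same value bound a loop, and removing the part of `A` between them
  -- would contradict minimality.
  have hinj : ∀ a ∈ A, ∀ b ∈ A, a < b → f a = f b → Ioo a b ∩ A = ∅ := by
    intro a ha b hb hab hfab
    have hmem : A \ Ioo a b ∈ loopErasures f := by
      refine ⟨hAc.sdiff isOpen_Ioo, ⟨h0, fun h => not_lt_bot h.1⟩, ⟨h1, fun h => not_top_lt h.2⟩,
        fun x hx y hy hxy hxygap => ?_⟩
      by_cases hempty : Ioo x y ∩ A = ∅
      · exact hgap x hx.1 y hy.1 hxy hempty
      · obtain ⟨z, ⟨hxz, hzy⟩, hzA⟩ := nonempty_iff_ne_empty.2 hempty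
        have hz : z ∈ Ioo a b := by
          by_contra hz
          exact (hxygap ▸ (⟨⟨hxz, hzy⟩, hzA, hz⟩ : z ∈ Ioo x y ∩ (A \ Ioo a b)) :
            z ∈ (∅ : Set I)).elim
        have key : ∀ w ∈ A, w ∉ Ioo a b → w ∉ Ioo x y := fun w hwA hw hwxy =>
          (hxygap ▸ (⟨hwxy, hwA, hw⟩ : w ∈ Ioo x y ∩ (A \ Ioo a b)) : w ∈ (∅ : Set I)).elim
        have hxa : x = a := by
          refine le_antisymm ?_ ?_
          · by_contra hlt
            exact hx.2 ⟨not_le.1 hlt, hxz.trans hz.2⟩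
          · by_contra hlt
            exact key a ha (fun h => lt_irrefl _ h.1) ⟨not_le.1 hlt, hz.1.trans hzy⟩
        have hyb : y = b := by
          refine le_antisymm ?_ ?_
          · by_contra hlt
            exact key b hb (fun h => lt_irrefl _ h.2) ⟨hxz.trans hz.2, not_le.1 hlt⟩
          · by_contra hlt
            exact hy.2 ⟨hz.1.trans hzy, not_le.1 hlt⟩
        rw [hxa, hyb, hfab]
    refine eq_empty_of_forall_notMem fun x ⟨hx, hxA⟩ => ?_
    exact (hmin hmem sdiff_subset hxA).2 hx
  refine ⟨f ∘ lo, ?_, ?_, ?_, ?_, range_comp_subset_range _ _⟩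
  · rw [continuous_iff_continuousAt]
    intro t
    by_cases ht : t ∈ A
    · rw [Metric.continuousAt_iff]
      intro ε hε
      obtain ⟨δ, hδ, hδf⟩ := Metric.continuousAt_iff.1 (hf.continuousAt (x := t)) ε hε
      refine ⟨δ, hδ, fun {s} hs => ?_⟩
      have key : ∀ u : I, u ∈ uIcc s t → dist (f u) (f t) < ε := fun u hu => by
        refine hδf (lt_of_le_of_lt ?_ hs)
        rw [Subtype.dist_eq, Subtype.dist_eq]
        refine Real.dist_right_le_of_mem_uIcc ?_
        rcases mem_uIcc.1 hu with h | h
        · exact mem_uIcc.2 (Or.inl h)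
        · exact mem_uIcc.2 (Or.inr h)
      rw [Function.comp_apply, Function.comp_apply, hloid t ht]
      rcases le_total t s with hts | hts
      · exact key _ (mem_uIcc.2 (Or.inr ⟨(hlo s).2 ⟨ht, hts⟩, hlole s⟩))
      -- Left of `t` the point `lo s` may be far away, but `hi s` lies between `s` and `t` and has
      -- the same value.
      · rw [← hlohi]
        exact key _ (mem_uIcc.2 (Or.inl ⟨(hhi s).1.2, (hhi s).2 ⟨ht, hts⟩⟩))
    · have hIoo : Ioo (lo t) (hi t) ∈ 𝓝 t := Ioo_mem_nhds
        ((hlole t).lt_of_ne fun h => ht (h ▸ hloA t))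
        ((show t ≤ hi t from (hhi t).1.2).lt_of_ne fun h => ht (h ▸ (hhi t).1.1))
      have hAgap : ∀ x ∈ A, x < hi t → x ≤ lo t := fun x hx hxt => by
        by_contra hlt
        rcases le_total x t with h | h
        · exact hlt ((hlo t).2 ⟨hx, h⟩)
        · exact ((hhi t).2 ⟨hx, h⟩).not_gt hxt
      refine (continuousAt_const (y := f (lo t))).congr ?_
      filter_upwards [hIoo] with s hs
      rw [Function.comp_apply]
      congr 1
      exact le_antisymm ((hlo s).2 ⟨hloA t, hs.1.le⟩)
        (hAgap _ (hloA s) ((hlole s).trans_lt hs.2))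
  · intro s u t hsu hut heq
    simp only [Function.comp_apply] at heq ⊢
    rcases (hlomono (hsu.trans hut)).eq_or_lt with h | h
    · rw [le_antisymm (h ▸ hlomono hut) (hlomono hsu)]
    · have hempty := hinj _ (hloA s) _ (hloA t) h heq
      rcases (hlomono hsu).eq_or_lt with h' | h'
      · rw [h']
      · rcases (hlomono hut).eq_or_lt with h'' | h''
        · rw [h'', heq]
        · exact (hempty ▸ (⟨⟨h', h''⟩, hloA u⟩ : lo u ∈ Ioo (lo s) (lo t) ∩ A) :
            lo u ∈ (∅ : Set I)).elim
  · rw [Function.comp_apply, hloid 0 h0]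
  · rw [Function.comp_apply, hloid 1 h1]

/-- Points joined by a path are joined by an arc inside the path. -/
theorem Path.exists_injective {X : Type*} [MetricSpace X] {x y : X} (p : Path x y) (hxy : x ≠ y) :
    ∃ γ : Path x y, Function.Injective γ ∧ range γ ⊆ range p := by
  obtain ⟨g, hg, hfib, h0, h1, hgp⟩ := exists_monotone_fibers p.continuous
  rw [p.source] at h0
  rw [p.target] at h1
  obtain ⟨γ, hγ, h0', h1', hγg⟩ := exists_injective_of_monotone_fibers hg hfib
    (by rwa [h0, h1])
  exact ⟨⟨γ, h0'.trans h0, h1'.trans h1⟩, hγ, hγg.trans hgp⟩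

/-- An arc with endpoints in a closed set `K` that leaves `K` contains an arc that meets `K`
exactly in its endpoints. -/
theorem exists_crosscut {X : Type*} [TopologicalSpace X] {K : Set X} (hK : IsClosed K) {x y : X}
    (p : Path x y) (hp : Function.Injective p) (hx : x ∈ K) (hy : y ∈ K) {t : I} (ht : p t ∉ K) :
    ∃ (a b : X) (γ : Path a b), Function.Injective γ ∧ a ∈ K ∧ b ∈ K ∧
      ∀ s, γ s ∈ K → s = 0 ∨ s = 1 := by
  have hKp := hK.preimage p.continuous
  -- The last time in `K` before `t` and the first one after it; `e` rescales the interval between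
  -- them.
  obtain ⟨c, ⟨hcK, hct⟩, hcmax⟩ := ((hKp.inter isClosed_Iic).isCompact
    (s := p ⁻¹' K ∩ Iic t)).exists_isGreatest ⟨0, by simpa using hx, nonneg'⟩
  obtain ⟨d, ⟨hdK, htd⟩, hdmin⟩ := ((hKp.inter isClosed_Ici).isCompact
    (s := p ⁻¹' K ∩ Ici t)).exists_isLeast ⟨1, by simpa using hy, le_one'⟩
  have hct' : c < t := lt_of_le_of_ne hct fun h => ht (h ▸ hcK)
  have htd' : t < d := lt_of_le_of_ne htd fun h => ht (h ▸ hdK)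
  have hcd : (0 : ℝ) < d - c := sub_pos.2 (hct'.trans htd')
  let e : I → I := fun s => ⟨c + s * (d - c), add_nonneg c.2.1 (mul_nonneg s.2.1 hcd.le), by
    nlinarith [s.2.2, d.2.2]⟩
  have he : Continuous e := by fun_prop
  have he_inj : Function.Injective e := fun s s' h => by
    have h := Subtype.ext_iff.1 h
    simp only [e, add_right_inj, mul_left_inj' hcd.ne'] at h
    exact Subtype.ext h
  refine ⟨p c, p d, ⟨⟨p ∘ e, p.continuous.comp he⟩, ?_, ?_⟩, hp.comp he_inj, hcK, hdK,
    fun s hs => ?_⟩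
  · exact congrArg p (Subtype.ext (by simp [e]))
  · exact congrArg p (Subtype.ext (by simp [e]))
  · have hs' : p (e s) ∈ K := hs
    rcases le_total (e s) t with h | h
    · have h1 : (e s : ℝ) ≤ c := hcmax ⟨hs', h⟩
      simp only [e] at h1
      have h2 : (s : ℝ) ≤ 0 := by
        by_contra h3
        nlinarith [mul_pos (not_le.1 h3) hcd]
      exact Or.inl (le_antisymm h2 s.2.1)
    · have h1 : (d : ℝ) ≤ e s := hdmin ⟨hs', h⟩
      simp only [e] at h1
      have h2 : 1 ≤ (s : ℝ) := by
        by_contra h3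
        nlinarith [mul_pos (sub_pos.2 (not_le.1 h3)) hcd]
      exact Or.inr (le_antisymm s.2.2 h2)

/-- The union of two arcs with the same endpoints and otherwise disjoint is a simple closed
curve. -/
theorem isSimpleClosedCurve_of_arcs {X : Type*} [TopologicalSpace X] [T2Space X] {x y : X}
    (α β : Path x y) (hα : Function.Injective α) (hβ : Function.Injective β)
    (hαβ : ∀ s t, α s = β t → s = 0 ∨ s = 1) :
    ∃ S : Set X, IsSimpleClosedCurve S ∧ range α ⊆ S := by
  -- The loop along `α` and back along `β` is injective on `[0, 1)`, so it descends to an injective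
  -- map from the circle.
  let p : Path x x := α.trans β.symm
  have hpinj : InjOn p.extend (Ico 0 1) := by
    have hβ' : Function.Injective β.symm := fun s t h => by
      simpa using hβ h
    have cross : ∀ s t : I, (t : ℝ) ≠ 1 → (t : ℝ) ≠ 0 → α s ≠ β.symm t := by
      intro s t ht1 ht0 h
      have hst : α s = β (σ t) := h
      rcases hαβ s _ hst with rfl | rfl
      · have := hβ ((β.source.trans α.source.symm).trans hst)
        have h2 := Subtype.ext_iff.1 this
        simp only [unitInterval.coe_symm_eq, Icc.coe_zero] at h2
        exact ht1 (by linarith)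
      · have := hβ ((β.target.trans α.target.symm).trans hst)
        have h2 := Subtype.ext_iff.1 this
        simp only [unitInterval.coe_symm_eq, Icc.coe_one] at h2
        exact ht0 (by linarith)
    intro s hs t ht hst
    rw [Path.extend_apply _ ⟨hs.1, hs.2.le⟩, Path.extend_apply _ ⟨ht.1, ht.2.le⟩,
      Path.trans_apply, Path.trans_apply] at hst
    split_ifs at hst with h1 h2 h2
    · have := Subtype.ext_iff.1 (hα hst)
      simp only at this
      linarith
    · refine absurd hst (cross _ _ ?_ ?_)
      · have := ht.2
        simp only; intro; linarith
      · simp only at h2 ⊢; intro; linarith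
    · refine absurd hst.symm (cross _ _ ?_ ?_)
      · have := hs.2
        simp only; intro; linarith
      · simp only at h1 ⊢; intro; linarith
    · have := Subtype.ext_iff.1 (hβ' hst)
      simp only at this
      linarith
  have h0 : p.extend 0 = p.extend 1 := by simp
  let f : AddCircle (1 : ℝ) → X := AddCircle.liftIco 1 0 p.extend
  have hf : Continuous f := AddCircle.liftIco_zero_continuous h0 p.continuous_extend.continuousOn
  have : Fact ((0 : ℝ) < 1) := ⟨zero_lt_one⟩
  have hrep : ∀ a : AddCircle (1 : ℝ), ∃ s ∈ Ico (0 : ℝ) 1, (s : AddCircle (1 : ℝ)) = a :=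
    fun a => by
      have := AddCircle.coe_image_Ico_eq (1 : ℝ) 0
      rw [zero_add] at this
      exact (this ▸ mem_univ a : a ∈ ((↑) : ℝ → AddCircle (1 : ℝ)) '' Ico 0 1)
  have hfs : ∀ s ∈ Ico (0 : ℝ) 1, f s = p.extend s := fun s hs =>
    AddCircle.liftIco_zero_coe_apply hs
  have hinj : Function.Injective f := fun a b hab => by
    obtain ⟨s, hs, rfl⟩ := hrep a
    obtain ⟨t, ht, rfl⟩ := hrep b
    rw [hfs s hs, hfs t ht] at hab
    rw [hpinj hs ht hab]
  refine ⟨range f, ⟨(hf.isClosedEmbedding hinj).isEmbedding.toHomeomorph.symm.trans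
    (AddCircle.homeomorphCircle one_ne_zero)⟩, ?_⟩
  have hrange : range α ⊆ range p := by
    rw [Path.trans_range]
    exact subset_union_left
  refine hrange.trans ?_
  rintro _ ⟨t, rfl⟩
  rcases t.2.2.eq_or_lt with h | h
  · refine ⟨((0 : ℝ) : AddCircle (1 : ℝ)), ?_⟩
    rw [hfs 0 ⟨le_rfl, zero_lt_one⟩, h0, ← h, Path.extend_apply _ t.2]
  · exact ⟨((t : ℝ) : AddCircle (1 : ℝ)), by rw [hfs t ⟨t.2.1, h⟩, Path.extend_apply _ t.2]⟩

end Arcs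

/-! ### Two limit points in the base produce a curve outside it. -/

section CrosscutCurve

open Set unitInterval

/-- If the closure of a connected open set `C` in the complement of an arcwise connected closed
subspace `G` meets `G` in two points, then there is a simple closed curve not contained in `G`. -/
theorem exists_isSimpleClosedCurve_not_subset {X G : Type*} [MetricSpace X] [CompactSpace X]
    [LocallyConnectedSpace X] [TopologicalSpace G] [PathConnectedSpace G] {i : G → X}
    (hi : IsClosedEmbedding i) {C : Set X} (hC : IsOpen C) (hCc : IsPreconnected C)
    (hCi : Disjoint C (range i)) {a b : G} (hab : a ≠ b) (ha : i a ∈ closure C)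
    (hb : i b ∈ closure C) : ∃ S : Set X, IsSimpleClosedCurve S ∧ ¬ S ⊆ range i := by
  have := locallyPathConnectedSpace_of_completeSpace X
  obtain ⟨U₀, V₀, hU₀, hV₀, haU₀, hbV₀, hdisj⟩ := t2_separation (hi.injective.ne hab)
  have hbasis := locallyConnectedSpace_iff_subsets_isOpen_isConnected.1 ‹LocallyConnectedSpace X›
  obtain ⟨U, hUU₀, hU, haU, hUc⟩ := hbasis (i a) U₀ (hU₀.mem_nhds haU₀)
  obtain ⟨V, hVV₀, hV, hbV, hVc⟩ := hbasis (i b) V₀ (hV₀.mem_nhds hbV₀)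
  have hUV : Disjoint U V := hdisj.mono hUU₀ hVV₀
  -- `U` and `V` are small connected neighborhoods of the two limit points, so both meet `C`.
  have hW : IsConnected (U ∪ C ∪ V) := by
    refine ⟨⟨i a, Or.inl (Or.inl haU)⟩, ?_⟩
    obtain ⟨x, hxU, hxC⟩ := mem_closure_iff.1 ha U hU haU
    obtain ⟨y, hyV, hyC⟩ := mem_closure_iff.1 hb V hV hbV
    exact (hUc.isPreconnected.union x hxU hxC hCc).union y (Or.inr hyC) hyV hVc.isPreconnected
  obtain ⟨p, hp⟩ := (((hU.union hC).union hV).isConnected_iff_isPathConnected.1 hW).joinedIn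
    (i a) (Or.inl (Or.inl haU)) (i b) (Or.inr hbV)
  obtain ⟨q, hq, hqp⟩ := p.exists_injective (hi.injective.ne hab)
  have hqW : ∀ t, q t ∈ U ∪ C ∪ V := fun t => by
    obtain ⟨s, hs⟩ := hqp (mem_range_self t)
    exact hs ▸ hp s
  -- An arc inside `G` would avoid `C`, hence lie in the disjoint union of `U` and `V` while meeting
  -- both.
  obtain ⟨t, ht⟩ : ∃ t, q t ∉ range i := by
    by_contra! hall
    have hsub : range q ⊆ U ∪ V := by
      rintro _ ⟨t, rfl⟩
      rcases hqW t with (h | h) | h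
      · exact Or.inl h
      · exact (disjoint_left.1 hCi h (hall t)).elim
      · exact Or.inr h
    rcases (isPreconnected_range q.continuous).subset_or_subset hU hV hUV hsub with h | h
    · exact disjoint_left.1 hUV (h ⟨1, q.target⟩) hbV
    · exact disjoint_left.1 hUV haU (h ⟨0, q.source⟩)
  obtain ⟨_, _, α, hα, ⟨g, rfl⟩, ⟨h, rfl⟩, hαK⟩ := exists_crosscut hi.isClosed_range q hq
    (mem_range_self a) (mem_range_self b) ht
  have hgh : i g ≠ i h := fun heq => by
    have h1 : α 0 = α 1 := by rw [α.source, α.target, heq]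
    exact zero_ne_one (hα h1)
  obtain ⟨β₀⟩ := PathConnectedSpace.joined g h
  obtain ⟨β, hβ, hββ⟩ := (β₀.map hi.continuous).exists_injective hgh
  have hβi : ∀ t, β t ∈ range i := fun t => by
    obtain ⟨s, hs⟩ := hββ (mem_range_self t)
    exact ⟨β₀ s, hs⟩
  obtain ⟨S, hS, hαS⟩ := isSimpleClosedCurve_of_arcs α β hα hβ fun s t hst =>
    hαK s (hst ▸ hβi t)
  refine ⟨S, hS, fun hSi => ?_⟩
  -- The midpoint of the crosscut is interior to it, hence outside `G`.
  rcases hαK ⟨1 / 2, by norm_num, by norm_num⟩ (hSi (hαS (mem_range_self _))) with h | h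
  · have := Subtype.ext_iff.1 h
    norm_num at this
  · have := Subtype.ext_iff.1 h
    norm_num at this

end CrosscutCurve

/-! ### Elementary facts on simple closed curves and local dendrites. -/

section Basic

open Set

theorem IsSimpleClosedCurve.image {X Y : Type*} [TopologicalSpace X] [TopologicalSpace Y]
    {S : Set X} (hS : IsSimpleClosedCurve S) {f : X → Y} (hf : IsEmbedding f) :
    IsSimpleClosedCurve (f '' S) :=
  let ⟨e⟩ := hS
  ⟨(hf.homeomorphImage S).symm.trans e⟩

theorem IsSimpleClosedCurve.not_subsingleton {X : Type*} [TopologicalSpace X] {S : Set X}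
    (hS : IsSimpleClosedCurve S) : ¬ S.Subsingleton := by
  obtain ⟨e⟩ := hS
  intro h
  have h1 : e.symm 1 = e.symm (-1) := Subtype.ext (h (e.symm 1).2 (e.symm (-1)).2)
  have h2 := congrArg (fun z : Circle => (z : ℂ).re) (e.symm.injective h1)
  norm_num at h2

theorem IsLocalDendrite.locallyConnectedSpace {X : Type*} [TopologicalSpace X]
    (hX : IsLocalDendrite X) : LocallyConnectedSpace X := by
  rw [locallyConnectedSpace_iff_connected_subsets]
  intro x U hU
  obtain ⟨N, hN, hNd⟩ := hX.exists_nhds x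
  have hxN := mem_of_mem_nhds hN
  obtain ⟨V, hV, hVc, hVU⟩ := locallyConnectedSpace_iff_connected_subsets.1 hNd.locallyConnected
    ⟨x, hxN⟩ (Subtype.val ⁻¹' U) (continuous_subtype_val.continuousAt.preimage_mem_nhds hU)
  refine ⟨Subtype.val '' V, ?_, hVc.image _ continuous_subtype_val.continuousOn,
    image_subset_iff.2 hVU⟩
  have h := Filter.image_mem_map (m := Subtype.val) hV
  rwa [map_nhds_subtype_val, nhdsWithin_eq_nhds.2 hN] at h

theorem IsLocalDendrite.pathConnectedSpace {X : Type*} [TopologicalSpace X]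
    (hX : IsLocalDendrite X) : PathConnectedSpace X := by
  have := hX.continuum.compact
  have := hX.continuum.connected
  have := hX.continuum.metrizable
  have := hX.locallyConnectedSpace
  let _ := TopologicalSpace.metrizableSpaceMetric X
  have := locallyPathConnectedSpace_of_completeSpace X
  exact pathConnectedSpace_iff_connectedSpace.2 inferInstance

end Basic

/-! ### Components of the complement of `G` and the canonical retraction. -/

namespace GDendrite

open Set

variable {G : Type u} [TopologicalSpace G]

instance (X : GDendrite G) : CompactSpace X := X.isLocalDendrite.continuum.compact

instance (X : GDendrite G) : ConnectedSpace X := X.isLocalDendrite.continuum.connected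

instance (X : GDendrite G) : TopologicalSpace.MetrizableSpace X :=
  X.isLocalDendrite.continuum.metrizable

instance (X : GDendrite G) : LocallyConnectedSpace X := X.isLocalDendrite.locallyConnectedSpace

theorem isClosedEmbedding [CompactSpace G] (X : GDendrite G) : IsClosedEmbedding X.incl :=
  X.isEmbedding.continuous.isClosedEmbedding X.isEmbedding.injective

theorem subset_range_of_isSimpleClosedCurve (X : GDendrite G) {S : Set X}
    (hS : IsSimpleClosedCurve S) : S ⊆ range X.incl := fun _ hx =>
  X.coreSkeleton_subset ⟨⟨S, hS⟩, fun _ _ hK => hK S hS hx⟩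

/-- The component of a point in the complement of `G`. -/
def branch (X : GDendrite G) (x : X) : Set X := connectedComponentIn (range X.incl)ᶜ x

theorem mem_branch {X : GDendrite G} {x : X} (hx : x ∉ range X.incl) : x ∈ X.branch x :=
  mem_connectedComponentIn hx

theorem branch_subset {X : GDendrite G} {x : X} : X.branch x ⊆ (range X.incl)ᶜ :=
  connectedComponentIn_subset _ _

theorem isPreconnected_branch {X : GDendrite G} {x : X} : IsPreconnected (X.branch x) :=
  isPreconnected_connectedComponentIn

theorem branch_eq {X : GDendrite G} {x y : X} (h : y ∈ X.branch x) : X.branch x = X.branch y :=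
  connectedComponentIn_eq h

theorem isOpen_branch [CompactSpace G] {X : GDendrite G} {x : X} : IsOpen (X.branch x) :=
  X.isClosedEmbedding.isClosed_range.isOpen_compl.connectedComponentIn

/-- Adjoining a limit point keeps a component connected, so a limit point outside `G` already
belongs to it. -/
theorem closure_branch_subset {X : GDendrite G} {x : X} (hx : x ∉ range X.incl) :
    closure (X.branch x) ⊆ X.branch x ∪ range X.incl := fun z hz => by
  by_cases hzr : z ∈ range X.incl
  · exact Or.inr hzr
  · refine Or.inl ?_
    have h1 : IsPreconnected (insert z (X.branch x)) :=
      isPreconnected_branch.subset_closure (subset_insert _ _)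
        (insert_subset hz subset_closure)
    exact h1.subset_connectedComponentIn (Or.inr (mem_branch hx))
      (insert_subset hzr branch_subset) (Or.inl rfl)

/-- Without a limit point in `G` the component would be clopen; with two, there would be a simple
closed curve not contained in `G`. -/
theorem exists_closure_branch_inter (hG : IsLocalDendrite G) {X : GDendrite G} {x : X}
    (hx : x ∉ range X.incl) : ∃ g, closure (X.branch x) ∩ range X.incl = {X.incl g} := by
  have := hG.continuum.compact
  have := hG.continuum.connected
  have := hG.pathConnectedSpace
  obtain ⟨_, hgc, g, rfl⟩ : (closure (X.branch x) ∩ range X.incl).Nonempty := by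
    by_contra hne
    rw [not_nonempty_iff_eq_empty] at hne
    have hcl : IsClosed (X.branch x) := by
      refine isClosed_of_closure_subset fun z hz => ?_
      rcases closure_branch_subset hx hz with h | h
      · exact h
      · exact (hne ▸ (⟨hz, h⟩ : z ∈ closure (X.branch x) ∩ range X.incl) : z ∈ (∅ : Set X)).elim
    have huniv := IsClopen.eq_univ ⟨hcl, isOpen_branch⟩ ⟨x, mem_branch hx⟩
    obtain ⟨g⟩ := (inferInstance : Nonempty G)
    exact branch_subset (huniv ▸ mem_univ (X.incl g)) (mem_range_self g)
  refine ⟨g, Subset.antisymm ?_ (singleton_subset_iff.2 ⟨hgc, mem_range_self g⟩)⟩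
  rintro _ ⟨hhc, h, rfl⟩
  by_contra hne
  let _ := TopologicalSpace.metrizableSpaceMetric X
  obtain ⟨S, hS, hSr⟩ := exists_isSimpleClosedCurve_not_subset X.isClosedEmbedding
    isOpen_branch isPreconnected_branch (disjoint_left.2 fun y (hy : y ∈ X.branch x) =>
      branch_subset hy) (a := g) (b := h) (fun e => hne (e ▸ rfl)) hgc hhc
  exact hSr (X.subset_range_of_isSimpleClosedCurve hS)

theorem eq_of_mem_branch {X : GDendrite G} {r : X → G}
    (hr : ∀ x ∉ range X.incl, closure (X.branch x) ∩ range X.incl = {X.incl (r x)}) {x y : X}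
    (hx : x ∉ range X.incl) (hy : y ∈ X.branch x) : r y = r x := by
  have h := hr y (branch_subset hy)
  rw [← branch_eq hy, hr x hx] at h
  exact (X.isEmbedding.injective (singleton_injective h)).symm

theorem exists_isCanonicalRetraction (hG : IsLocalDendrite G) (X : GDendrite G) :
    ∃ r, X.IsCanonicalRetraction r := by
  have := hG.continuum.compact
  have key : ∀ x : X, ∃ g, (∀ h, X.incl h = x → g = h) ∧
      (x ∉ range X.incl → closure (X.branch x) ∩ range X.incl = {X.incl g}) := fun x => by
    by_cases hx : x ∈ range X.incl
    · obtain ⟨g, rfl⟩ := hx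
      exact ⟨g, fun h e => (X.isEmbedding.injective e).symm,
        fun h => absurd (mem_range_self g) h⟩
    · obtain ⟨g, hg⟩ := exists_closure_branch_inter hG hx
      exact ⟨g, fun h e => absurd ⟨h, e⟩ hx, fun _ => hg⟩
  choose r hr1 hr2 using key
  refine ⟨r, ?_, fun g => hr1 _ g rfl, hr2⟩
  rw [continuous_iff_continuousAt]
  intro x
  by_cases hx : x ∈ range X.incl
  · obtain ⟨g, rfl⟩ := hx
    intro U hU
    rw [hr1 _ g rfl, X.isEmbedding.nhds_eq_comap] at hU
    obtain ⟨V, hV, hVU⟩ := hU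
    obtain ⟨W, hWV, hW, hgW, hWc⟩ := locallyConnectedSpace_iff_subsets_isOpen_isConnected.1
      (inferInstance : LocallyConnectedSpace X) _ V hV
    refine Filter.mem_map.2 <| Filter.mem_of_superset (hW.mem_nhds hgW) fun y hy => hVU (hWV ?_)
    by_cases hyr : y ∈ range X.incl
    · obtain ⟨h, rfl⟩ := hyr
      rwa [hr1 _ h rfl]
    · by_contra hyW
      -- If the limit point of the component of `y` is outside `W`, the component is relatively
      -- closed in the connected set `W`, so it swallows `W` and with it a point of `G`.
      have hsub : W ⊆ X.branch y := hWc.isPreconnected.subset_of_closure_inter_subset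
        isOpen_branch ⟨y, hy, mem_branch hyr⟩ fun z ⟨hz, hzW⟩ =>
          (closure_branch_subset hyr hz).resolve_right fun hzr => by
            have hz' : z ∈ closure (X.branch y) ∩ range X.incl := ⟨hz, hzr⟩
            rw [hr2 y hyr] at hz'
            exact hyW (hz' ▸ hzW)
      exact branch_subset (hsub hgW) (mem_range_self g)
  · refine (continuousAt_const (y := r x)).congr ?_
    filter_upwards [isOpen_branch.mem_nhds (mem_branch hx)] with y hy
    exact (eq_of_mem_branch hr2 hx hy).symm

namespace IsCanonicalRetraction

variable {X Y : GDendrite G} {r : X → G} {r' : Y → G}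

theorem apply_eq_of_mem_branch (hr : X.IsCanonicalRetraction r) {x y : X}
    (hx : x ∉ range X.incl) (hy : y ∈ X.branch x) : r y = r x :=
  eq_of_mem_branch hr.closure_inter hx hy

theorem incl_mem_closure_branch (hr : X.IsCanonicalRetraction r) {x : X}
    (hx : x ∉ range X.incl) : X.incl (r x) ∈ closure (X.branch x) :=
  ((hr.closure_inter x hx).symm ▸ rfl :
    X.incl (r x) ∈ closure (X.branch x) ∩ range X.incl).1

/-- The retraction is constant on each component, so this is a union of open components. -/
theorem isOpen_fiber_diff [CompactSpace G] (hr : X.IsCanonicalRetraction r) (g : G) :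
    IsOpen (r ⁻¹' {g} \ {X.incl g}) := by
  rw [isOpen_iff_mem_nhds]
  rintro x ⟨hxg, hx⟩
  have hxr : x ∉ range X.incl := by
    rintro ⟨h, rfl⟩
    rw [mem_preimage, hr.map_incl] at hxg
    exact hx (hxg ▸ rfl)
  refine Filter.mem_of_superset (isOpen_branch.mem_nhds (mem_branch hxr)) fun y hy =>
    ⟨(hr.apply_eq_of_mem_branch hxr hy).trans hxg, fun h => branch_subset hy ?_⟩
  rw [mem_singleton_iff.1 h]
  exact mem_range_self g

/-- The closures of the components over `g` all contain `g`, which gives connectedness. Local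
connectedness passes to the fiber as a quotient of `X`. A simple closed curve would lie in `G`,
which meets the fiber in one point. -/
theorem isDendrite_fiber [CompactSpace G] [T1Space G] (hr : X.IsCanonicalRetraction r) (g : G) :
    IsDendrite {x : X // r x = g} := by
  change IsDendrite {x : X | r x = g}
  have hcl : IsClosed {x : X | r x = g} := isClosed_singleton.preimage hr.continuous
  refine ⟨⟨isCompact_iff_compactSpace.1 hcl.isCompact, ?_, ?_⟩, ?_, fun S hS => ?_⟩
  · refine isConnected_iff_connectedSpace.1
      ⟨⟨X.incl g, hr.map_incl g⟩, ?_⟩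
    refine isPreconnected_of_forall (X.incl g) fun x hx => ?_
    by_cases hxr : x ∈ range X.incl
    · obtain ⟨h, rfl⟩ := hxr
      obtain rfl : h = g := (hr.map_incl h).symm.trans hx
      exact ⟨{X.incl h}, singleton_subset_iff.2 hx, rfl, rfl, isPreconnected_singleton⟩
    · refine ⟨closure (X.branch x), closure_minimal (fun y hy => ?_) hcl, ?_,
        subset_closure (mem_branch hxr), isPreconnected_branch.closure⟩
      · exact (hr.apply_eq_of_mem_branch hxr hy).trans hx
      · have := hr.incl_mem_closure_branch hxr
        rwa [show r x = g from hx] at this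
  · exact inferInstance
  · classical
    -- Collapsing the complement of the fiber to `g` is continuous because the frontier of the fiber
    -- is at most `g`.
    have hρ : Continuous fun x => if r x = g then x else X.incl g := by
      refine Continuous.if (fun x hx => ?_) continuous_id continuous_const
      by_contra hne
      rw [hcl.frontier_eq] at hx
      exact hx.2 (mem_interior.2 ⟨_, fun y hy => hy.1, hr.isOpen_fiber_diff g, hx.1, hne⟩)
    let ρ : X → {x : X // r x = g} := fun x => ⟨if r x = g then x else X.incl g, by
      split_ifs with h
      exacts [h, hr.map_incl g]⟩
    have hρc : Continuous ρ := hρ.subtype_mk _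
    have hq : IsQuotientMap ρ := .of_comp continuous_subtype_val hρc (by
      have : ρ ∘ Subtype.val = id := by
        funext x
        exact Subtype.ext (if_pos x.2)
      rw [this]
      exact .id)
    exact hq.isCoinducing.locallyConnectedSpace
  · have hS' := hS.image IsEmbedding.subtypeVal
    refine hS'.not_subsingleton ?_
    have : ∀ x ∈ Subtype.val '' S, x = X.incl g := fun x hx => by
      obtain ⟨h, rfl⟩ := X.subset_range_of_isSimpleClosedCurve hS' hx
      obtain ⟨y, -, hy⟩ := hx
      rw [← hr.map_incl h, ← hy, y.2]
    exact fun x hx y hy => (this x hx).trans (this y hy).symm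

/-- Only points of `G` are mapped into `G`, so a component goes into a component, and continuity
carries its limit point along. -/
theorem comp_hom (hr : X.IsCanonicalRetraction r) (hr' : Y.IsCanonicalRetraction r')
    (f : X ⟶ Y) (x : X) : r' (Hom.toFun f x) = r x := by
  by_cases hx : x ∈ range X.incl
  · obtain ⟨g, rfl⟩ := hx
    rw [f.map_incl, hr.map_incl, hr'.map_incl]
  · have hf : ∀ y ∉ range X.incl, Hom.toFun f y ∉ range Y.incl := fun y hy => by
      rintro ⟨g, hg⟩
      rw [← f.map_incl] at hg
      exact hy ⟨g, f.isEmbedding.injective hg⟩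
    have hsub : Hom.toFun f '' X.branch x ⊆ Y.branch (Hom.toFun f x) :=
      (isPreconnected_branch.image _ f.isEmbedding.continuous.continuousOn).subset_connectedComponentIn
        (mem_image_of_mem _ (mem_branch hx))
        (image_subset_iff.2 fun y hy => hf y (branch_subset hy))
    have hmem : Y.incl (r x) ∈ closure (Y.branch (Hom.toFun f x)) ∩ range Y.incl := by
      refine ⟨closure_mono hsub ?_, mem_range_self _⟩
      rw [← f.map_incl]
      exact image_closure_subset_closure_image f.isEmbedding.continuous
        (mem_image_of_mem _ (hr.incl_mem_closure_branch hx))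
    have h2 := hr'.closure_inter _ (hf x hx)
    rw [branch] at hmem
    rw [h2] at hmem
    exact (Y.isEmbedding.injective hmem).symm

theorem countable_nontrivial_fiber [CompactSpace G] (hr : X.IsCanonicalRetraction r) :
    {g | Nontrivial {x : X // r x = g}}.Countable := by
  let _ := TopologicalSpace.metrizableSpaceMetric X
  refine PairwiseDisjoint.countable_of_isOpen (s := fun g => r ⁻¹' {g} \ {X.incl g})
    (fun g _ h _ hgh => ?_) (fun g _ => hr.isOpen_fiber_diff g) fun g hg => ?_
  · exact disjoint_left.2 fun x hx hx' => hgh (hx.1.symm.trans hx'.1)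
  · have : Nontrivial {x : X // r x = g} := hg
    obtain ⟨x, hx⟩ := exists_ne (⟨X.incl g, hr.map_incl g⟩ : {x : X // r x = g})
    exact ⟨x, x.2, fun h => hx (Subtype.ext h)⟩

/-- Embeddings of the fibers that fix `G` glue to an embedding. -/
theorem isEmbedding_of_fibers [CompactSpace G] [T2Space G] (hr : X.IsCanonicalRetraction r)
    (hr' : Y.IsCanonicalRetraction r') {f : X → Y} (hf : ∀ g, ContinuousOn f (r ⁻¹' {g}))
    (hinj : ∀ g, InjOn f (r ⁻¹' {g})) (hcomp : ∀ x, r' (f x) = r x)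
    (hincl : ∀ g, f (X.incl g) = Y.incl g) : IsEmbedding f := by
  have hfinj : Function.Injective f := fun x y hxy =>
    hinj (r y) ((hcomp x).symm.trans ((congrArg r' hxy).trans (hcomp y))) rfl hxy
  suffices hc : Continuous f from (hc.isClosedEmbedding hfinj).isEmbedding
  rw [continuous_iff_continuousAt]
  intro x
  by_cases hx : x = X.incl (r x)
  · generalize r x = g at hx
    subst hx
    intro V₀ hV₀
    rw [hincl] at hV₀
    obtain ⟨V, hVV₀, hV, hgV⟩ := mem_nhds_iff.1 hV₀
    -- The points outside `V`, apart from the fiber over `g`, form a compact set whose image under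
    -- `r'` misses `g`. Over base points near `g` and different from it, whole fibers thus lie in
    -- `V`; over `g` itself the continuity of `f` on the fiber suffices.
    have hB : IsClosed (Vᶜ \ (r' ⁻¹' {g} \ {Y.incl g})) :=
      hV.isClosed_compl.sdiff (hr'.isOpen_fiber_diff g)
    have hrB : IsClosed (r' '' (Vᶜ \ (r' ⁻¹' {g} \ {Y.incl g}))) :=
      (hB.isCompact.image hr'.continuous).isClosed
    have hgB : g ∉ r' '' (Vᶜ \ (r' ⁻¹' {g} \ {Y.incl g})) := by
      rintro ⟨y, ⟨hyV, hy⟩, hyg⟩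
      refine hy ⟨hyg, fun h => hyV ?_⟩
      rw [mem_singleton_iff.1 h]
      exact hgV
    have h1 : ∀ᶠ y in 𝓝 (X.incl g), r y ∉ r' '' (Vᶜ \ (r' ⁻¹' {g} \ {Y.incl g})) := by
      refine hr.continuous.continuousAt.eventually_mem (hrB.isOpen_compl.mem_nhds ?_)
      rwa [hr.map_incl]
    have h2 : ∀ᶠ y in 𝓝 (X.incl g), y ∈ r ⁻¹' {g} → f y ∈ V := by
      have := (hf g (X.incl g) (hr.map_incl g)).eventually_mem (s := V)
        (hV.mem_nhds (by rwa [hincl]))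
      exact eventually_nhdsWithin_iff.1 this
    refine Filter.mem_map.2 ?_
    filter_upwards [h1, h2] with y hy1 hy2
    refine hVV₀ ?_
    by_cases hyg : r y = g
    · exact hy2 hyg
    · by_contra hyV
      exact hy1 ⟨f y, ⟨hyV, fun h => hyg ((hcomp y).symm.trans h.1)⟩, hcomp y⟩
  · exact (hf (r x)).continuousAt (Filter.mem_of_superset
      ((hr.isOpen_fiber_diff (r x)).mem_nhds ⟨rfl, hx⟩) sdiff_subset)

end IsCanonicalRetraction

end GDendrite

/-! ### Preimages of simple closed curves, and removal of a point. -/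

section Basic

open Set

theorem IsSimpleClosedCurve.preimage {X Y : Type*} [TopologicalSpace X] [TopologicalSpace Y]
    {S : Set Y} (hS : IsSimpleClosedCurve S) {f : X → Y} (hf : IsEmbedding f)
    (hSf : S ⊆ range f) : IsSimpleClosedCurve (f ⁻¹' S) := by
  have h := hf.homeomorphImage (f ⁻¹' S)
  rw [image_preimage_eq_of_subset hSf] at h
  exact hS.map h.trans

theorem AddCircle.isPreconnected_compl_singleton (a : AddCircle (1 : ℝ)) :
    IsPreconnected {a}ᶜ := by
  have : Fact ((0 : ℝ) < 1) := ⟨zero_lt_one⟩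
  induction a using QuotientAddGroup.induction_on with | H a => ?_
  have h : ({(a : AddCircle (1 : ℝ))}ᶜ : Set _) = ((↑) : ℝ → AddCircle (1 : ℝ)) '' Ioo a (a + 1) := by
    ext b
    constructor
    · intro hb
      obtain ⟨s, hs, rfl⟩ := (AddCircle.coe_image_Ico_eq (1 : ℝ) a ▸ mem_univ b :
        b ∈ ((↑) : ℝ → AddCircle (1 : ℝ)) '' Ico a (a + 1))
      exact ⟨s, ⟨hs.1.lt_of_ne fun e => hb (e ▸ rfl), hs.2⟩, rfl⟩
    · rintro ⟨s, hs, rfl⟩ h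
      rw [mem_singleton_iff, AddCircle.coe_eq_coe_iff_of_mem_Ico ⟨hs.1.le, hs.2⟩
        ⟨le_rfl, by linarith⟩] at h
      exact hs.1.ne' h
  change IsPreconnected ({(a : AddCircle (1 : ℝ))}ᶜ)
  rw [h]
  exact isPreconnected_Ioo.image _ (AddCircle.continuous_mk' 1).continuousOn

/-- A circle has no cut point, so a simple closed curve cannot pass through the attaching point of a
dendrite and continue on both sides. -/
theorem IsSimpleClosedCurve.isPreconnected_diff_singleton {X : Type*} [TopologicalSpace X]
    {S : Set X} (hS : IsSimpleClosedCurve S) (x : X) : IsPreconnected (S \ {x}) := by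
  obtain ⟨e₀⟩ := hS
  let e : AddCircle (1 : ℝ) ≃ₜ S := (AddCircle.homeomorphCircle one_ne_zero).trans e₀.symm
  have he : Continuous fun a => (e a : X) := continuous_subtype_val.comp e.continuous
  by_cases hx : x ∈ S
  · have h : S \ {x} = (fun a => (e a : X)) '' {e.symm ⟨x, hx⟩}ᶜ := by
      ext y
      constructor
      · rintro ⟨hy, hyx⟩
        refine ⟨e.symm ⟨y, hy⟩, fun h => hyx ?_, by simp⟩
        exact Subtype.ext_iff.1 (e.symm.injective h)
      · rintro ⟨a, ha, rfl⟩
        refine ⟨(e a).2, fun h => ha ?_⟩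
        rw [mem_singleton_iff, Homeomorph.eq_symm_apply]
        exact Subtype.ext h
    rw [h]
    exact (AddCircle.isPreconnected_compl_singleton _).image _ he.continuousOn
  · have h : S \ {x} = range fun a => (e a : X) := by
      rw [sdiff_singleton_eq_self hx]
      ext y
      exact ⟨fun hy => ⟨e.symm ⟨y, hy⟩, by simp⟩, by rintro ⟨a, rfl⟩; exact (e a).2⟩
    rw [h]
    exact isPreconnected_range he

end Basic

namespace PointedDendrite

instance (P : PointedDendrite.{u}) : CompactSpace P := P.isDendrite.continuum.compact

instance (P : PointedDendrite.{u}) : ConnectedSpace P := P.isDendrite.continuum.connected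

instance (P : PointedDendrite.{u}) : TopologicalSpace.MetrizableSpace P :=
  P.isDendrite.continuum.metrizable

instance (P : PointedDendrite.{u}) : LocallyConnectedSpace P := P.isDendrite.locallyConnected

instance (P : PointedDendrite.{u}) : SecondCountableTopology P := by
  let _ := TopologicalSpace.metrizableSpaceMetric P
  infer_instance

/-- A homeomorphism preserving the distinguished point is an isomorphism of pointed dendrites. -/
def isoOfHomeomorph {P Q : PointedDendrite.{u}} (e : P ≃ₜ Q) (he : e P.point = Q.point) :
    P ≅ Q where
  hom := Hom.mk e e.isEmbedding he
  inv := Hom.mk e.symm e.symm.isEmbedding (by rw [← he, e.symm_apply_apply])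
  hom_inv_id := Hom.ext (funext e.symm_apply_apply)
  inv_hom_id := Hom.ext (funext e.apply_symm_apply)

end PointedDendrite

/-! ### Attaching pointed dendrites to the base. -/

section Attaching

open Set

variable {G : Type u}

/-- The space obtained from `G` by attaching to each point `g` the pointed dendrite `D g`, as a
subspace of the product of `G` and the nondegenerate dendrites. -/
def AttachedSpace (D : G → PointedDendrite.{u}) : Set (G × ∀ h : {g : G | Nontrivial (D g)}, D h) :=
  {q | ∀ h : {g : G | Nontrivial (D g)}, h.1 ≠ q.1 → q.2 h = (D h).point}

namespace AttachedSpace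

variable {D : G → PointedDendrite.{u}}

/-- The projection to the base. -/
def proj (q : AttachedSpace D) : G := q.1.1

open Classical in
/-- The inclusion of an attached dendrite. -/
noncomputable def fiberIncl (D : G → PointedDendrite.{u}) (g : G) (x : D g) : AttachedSpace D :=
  ⟨(g, fun h => if e : g = h.1 then e ▸ x else (D h).point), fun _ hh => dif_neg fun e => hh e.symm⟩

/-- The inclusion of the base. -/
def incl (D : G → PointedDendrite.{u}) (g : G) : AttachedSpace D :=
  ⟨(g, fun h => (D h).point), fun _ _ => rfl⟩

theorem fiberIncl_apply_self (g : G) (hg : Nontrivial (D g)) (x : D g) :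
    (fiberIncl D g x).1.2 ⟨g, hg⟩ = x := by
  simp [fiberIncl]

@[simp]
theorem fiberIncl_point (g : G) : fiberIncl D g (D g).point = incl D g := by
  refine Subtype.ext (Prod.ext rfl (funext fun ⟨h, hh⟩ => ?_))
  by_cases e : g = h
  · subst e
    simp [fiberIncl, incl]
  · simp [fiberIncl, incl, e]

theorem fiberIncl_injective (g : G) : Function.Injective (fiberIncl D g) := fun x y hxy => by
  by_cases hg : Nontrivial (D g)
  · rw [← fiberIncl_apply_self g hg x, hxy, fiberIncl_apply_self]
  · rw [not_nontrivial_iff_subsingleton] at hg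
    exact Subsingleton.elim _ _

theorem exists_fiberIncl_eq (q : AttachedSpace D) : ∃ x, fiberIncl D (proj q) x = q := by
  by_cases hg : Nontrivial (D (proj q))
  · refine ⟨q.1.2 ⟨proj q, hg⟩, Subtype.ext (Prod.ext rfl (funext fun h => ?_))⟩
    by_cases e : proj q = h
    · obtain ⟨h, hh⟩ := h
      subst e
      exact fiberIncl_apply_self _ _ _
    · rw [q.2 h (Ne.symm e)]
      simp [fiberIncl, e]
  · refine ⟨(D (proj q)).point, ?_⟩
    rw [fiberIncl_point]
    refine Subtype.ext (Prod.ext rfl (funext fun h => ?_))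
    exact (q.2 h fun e => hg (by rw [← show h.1 = proj q from e]; exact h.2)).symm

theorem range_fiberIncl (g : G) : range (fiberIncl D g) = proj ⁻¹' {g} := by
  ext q
  constructor
  · rintro ⟨x, rfl⟩
    rfl
  · rintro rfl
    exact exists_fiberIncl_eq q

variable [TopologicalSpace G]

theorem continuous_proj : Continuous (proj (D := D)) :=
  continuous_fst.comp continuous_subtype_val

theorem continuous_incl : Continuous (incl D) := by
  unfold incl
  fun_prop

theorem continuous_fiberIncl (g : G) : Continuous (fiberIncl D g) := by
  refine Continuous.subtype_mk (continuous_const.prodMk (continuous_pi fun ⟨h, hh⟩ => ?_)) _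
  by_cases e : g = h
  · subst e
    simp only [↓reduceDIte]
    exact continuous_id
  · simpa [e] using continuous_const

/-- If `D g` is nondegenerate, this is where the coordinate at `g` differs from the base point;
otherwise it is empty. -/
theorem isOpen_fiber_diff [T2Space G] (g : G) :
    IsOpen (proj (D := D) ⁻¹' {g} \ {incl D g}) := by
  by_cases hg : Nontrivial (D g)
  · have : proj (D := D) ⁻¹' {g} \ {incl D g} = {q | q.1.2 ⟨g, hg⟩ ≠ (D g).point} := by
      ext q
      constructor
      · rintro ⟨hq, hqg⟩ h
        obtain ⟨x, rfl⟩ := (range_fiberIncl g).symm ▸ hq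
        rw [fiberIncl_apply_self] at h
        exact hqg (by rw [h, fiberIncl_point]; rfl)
      · intro h
        have hq : g = proj q := by
          by_contra hne
          exact h (q.2 ⟨g, hg⟩ hne)
        refine ⟨hq.symm, fun hqg => h ?_⟩
        rw [mem_singleton_iff.1 hqg]
        rfl
    rw [this]
    exact isOpen_ne_fun
      ((continuous_apply (⟨g, hg⟩ : {g : G | Nontrivial (D g)})).comp
        (continuous_snd.comp continuous_subtype_val)) continuous_const
  · rw [not_nontrivial_iff_subsingleton] at hg
    have : proj (D := D) ⁻¹' {g} \ {incl D g} = ∅ := by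
      refine eq_empty_of_forall_notMem fun q ⟨hq, hqg⟩ => hqg ?_
      obtain ⟨x, rfl⟩ := (range_fiberIncl g).symm ▸ hq
      rw [Subsingleton.elim x (D g).point, fiberIncl_point]
      rfl
    rw [this]
    exact isOpen_empty

theorem isClosed_attachedSpace [T1Space G] : IsClosed (AttachedSpace D) := by
  have : AttachedSpace D = ⋂ h : {g : G | Nontrivial (D g)},
      {q : G × ∀ h : {g : G | Nontrivial (D g)}, D h | q.1 = h.1} ∪ {q | q.2 h = (D h).point} := by
    ext q
    simp only [AttachedSpace, mem_ofPred_eq, mem_iInter, mem_union]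
    exact forall_congr' fun h => by rw [ne_comm, ne_eq, or_iff_not_imp_left]
  rw [this]
  exact isClosed_iInter fun h => (isClosed_singleton.preimage continuous_fst).union
    (isClosed_eq ((continuous_apply h).comp continuous_snd) continuous_const)

theorem compactSpace [CompactSpace G] [T1Space G] : CompactSpace (AttachedSpace D) :=
  isCompact_iff_compactSpace.1 isClosed_attachedSpace.isCompact

theorem isClosedEmbedding_fiberIncl [T2Space G] (g : G) : IsClosedEmbedding (fiberIncl D g) :=
  (continuous_fiberIncl g).isClosedEmbedding (fiberIncl_injective g)

theorem isEmbedding_incl : IsEmbedding (incl D) :=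
  .of_comp continuous_incl continuous_proj .id

/-- Leaving out the one-point dendrites makes the product countable, hence second countable. -/
theorem metrizableSpace [CompactSpace G] [TopologicalSpace.MetrizableSpace G]
    (hD : {g : G | Nontrivial (D g)}.Countable) :
    TopologicalSpace.MetrizableSpace (AttachedSpace D) := by
  have : Countable {g : G | Nontrivial (D g)} := hD
  have := compactSpace (D := D)
  let _ := TopologicalSpace.metrizableSpaceMetric G
  exact TopologicalSpace.metrizableSpace_of_t3_secondCountable _

/-- Fibers over points close to `g`, apart from the fiber over `g`, are close to `g`. -/
theorem exists_isOpen_forall_proj_mem [T1Space G] {g : G} {V : Set (AttachedSpace D)}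
    (hV : V ∈ 𝓝 (incl D g)) :
    ∃ U, IsOpen U ∧ g ∈ U ∧ ∀ q : AttachedSpace D, proj q ∈ U → proj q ≠ g → q ∈ V := by
  rw [nhds_subtype_eq_comap] at hV
  obtain ⟨V', hV', hVV'⟩ := hV
  obtain ⟨U₀, hU₀, T, hT, hUT⟩ := mem_nhds_prod_iff.1 hV'
  rw [nhds_pi, Filter.mem_pi] at hT
  obtain ⟨F, hF, t, ht, htT⟩ := hT
  obtain ⟨U₁, hU₁, hU₁o, hgU₁⟩ := mem_nhds_iff.1 hU₀
  -- A basic neighborhood restricts only the finitely many coordinates in `F`. Over a base point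
  -- outside `F`, these coordinates are all base points.
  refine ⟨U₁ \ ((Subtype.val '' F) \ {g}),
    hU₁o.sdiff ((hF.image _).subset sdiff_subset).isClosed, ⟨hgU₁, fun h => h.2 rfl⟩,
    fun q ⟨hq, hqF⟩ hqg => hVV' (hUT ⟨hU₁ hq, htT fun h hh => ?_⟩)⟩
  have hne : h.1 ≠ q.1.1 := fun e => hqF ⟨⟨h, hh, e⟩, hqg⟩
  rw [q.2 h hne]
  exact mem_of_mem_nhds (ht h)

theorem isPreconnected_proj_preimage {N : Set G} (hN : IsPreconnected N) :
    IsPreconnected (proj (D := D) ⁻¹' N) := by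
  rcases N.eq_empty_or_nonempty with rfl | ⟨g, hg⟩
  · exact isPreconnected_empty
  refine isPreconnected_of_forall (incl D g) fun q hq => ?_
  refine ⟨incl D '' N ∪ range (fiberIncl D (proj q)), ?_, Or.inl ⟨g, hg, rfl⟩,
    Or.inr (exists_fiberIncl_eq q), ?_⟩
  · rw [range_fiberIncl]
    rintro _ (⟨h, hh, rfl⟩ | h)
    · exact hh
    · rwa [mem_preimage, h]
  · exact (hN.image _ continuous_incl.continuousOn).union (incl D (proj q)) ⟨_, hq, rfl⟩
      ⟨_, fiberIncl_point _⟩ (isPreconnected_range (continuous_fiberIncl _))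

/-- The set consists of the full fibers over a small connected `B`, except that over `g` only a
small connected `A` is kept. It is a neighborhood relative to the preimage of `N` because `N` need
not be open. -/
theorem exists_isPreconnected_of_incl [T2Space G] {N : Set G} [LocallyConnectedSpace N]
    {g : G} (hg : g ∈ N) {V : Set (AttachedSpace D)} (hV : V ∈ 𝓝 (incl D g)) :
    ∃ W ∈ 𝓝[proj ⁻¹' N] (incl D g), IsPreconnected W ∧ W ⊆ V ∩ proj ⁻¹' N := by
  obtain ⟨U, hU, hgU, hUV⟩ := exists_isOpen_forall_proj_mem hV
  obtain ⟨B, hB, hBc, hBU⟩ := locallyConnectedSpace_iff_connected_subsets.1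
    ‹LocallyConnectedSpace N› ⟨g, hg⟩ (Subtype.val ⁻¹' U)
    ((hU.preimage continuous_subtype_val).mem_nhds hgU)
  have hB' : Subtype.val '' B ∈ 𝓝[N] g := by
    have h := Filter.image_mem_map (m := Subtype.val) hB
    rwa [map_nhds_subtype_val] at h
  have hgB : g ∈ Subtype.val '' B := ⟨⟨g, hg⟩, mem_of_mem_nhds hB, rfl⟩
  have hBcon : IsPreconnected (Subtype.val '' B) :=
    hBc.image _ continuous_subtype_val.continuousOn
  obtain ⟨A, hAV, hA, hpA, hAc⟩ := locallyConnectedSpace_iff_subsets_isOpen_isConnected.1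
    (inferInstance : LocallyConnectedSpace (D g)) (D g).point (fiberIncl D g ⁻¹' V)
    ((continuous_fiberIncl g).continuousAt.preimage_mem_nhds (by rwa [fiberIncl_point]))
  have hclosed : IsClosed (fiberIncl D g '' Aᶜ) :=
    (isClosedEmbedding_fiberIncl g).isClosedMap _ hA.isClosed_compl
  have hincl : ∀ h, incl D h ∉ fiberIncl D g '' Aᶜ := fun h => by
    rintro ⟨x, hx, hxh⟩
    obtain rfl : g = h := congrArg proj hxh
    rw [← fiberIncl_point] at hxh
    exact hx (fiberIncl_injective _ hxh ▸ hpA)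
  refine ⟨proj ⁻¹' (Subtype.val '' B) \ fiberIncl D g '' Aᶜ, ?_, ?_, ?_⟩
  · refine Filter.inter_mem ?_ (mem_nhdsWithin_of_mem_nhds (hclosed.isOpen_compl.mem_nhds (hincl g)))
    exact (continuous_proj.continuousWithinAt (x := incl D g)).tendsto_nhdsWithin
      (mapsTo_preimage proj N) hB'
  · refine isPreconnected_of_forall (incl D g) fun q ⟨hq, hqA⟩ => ?_
    by_cases hqg : proj q = g
    · subst hqg
      refine ⟨fiberIncl D (proj q) '' A, ?_, ⟨_, hpA, fiberIncl_point _⟩, ?_,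
        hAc.isPreconnected.image _ (continuous_fiberIncl _).continuousOn⟩
      · rintro _ ⟨x, hx, rfl⟩
        exact ⟨hq, fun ⟨y, hy, hyx⟩ => hy (fiberIncl_injective _ hyx ▸ hx)⟩
      · obtain ⟨x, hx⟩ := exists_fiberIncl_eq q
        refine ⟨x, ?_, hx⟩
        by_contra hxA
        exact hqA ⟨x, hxA, hx⟩
    · refine ⟨incl D '' (Subtype.val '' B) ∪ range (fiberIncl D (proj q)), ?_,
        Or.inl ⟨g, hgB, rfl⟩, Or.inr (exists_fiberIncl_eq q), ?_⟩
      · rintro _ (⟨h, hh, rfl⟩ | ⟨x, rfl⟩)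
        · exact ⟨hh, hincl h⟩
        · exact ⟨hq, fun ⟨y, _, hy⟩ => hqg (congrArg proj hy).symm⟩
      · exact (hBcon.image _ continuous_incl.continuousOn).union (incl D (proj q)) ⟨_, hq, rfl⟩
          ⟨_, fiberIncl_point _⟩ (isPreconnected_range (continuous_fiberIncl _))
  · rintro q ⟨⟨b, hb, hbq⟩, hqA⟩
    refine ⟨?_, show proj q ∈ N from hbq ▸ b.2⟩
    by_cases hqg : proj q = g
    · subst hqg
      obtain ⟨x, hx⟩ := exists_fiberIncl_eq q
      rw [← hx]
      refine hAV ?_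
      by_contra hxA
      exact hqA ⟨x, hxA, hx⟩
    · exact hUV q (hbq ▸ hBU hb) hqg

/-- Away from the base a fiber is open, so local connectedness of the dendrite suffices. -/
theorem exists_isPreconnected_of_ne_incl [T2Space G] {q : AttachedSpace D}
    (hq : q ≠ incl D (proj q)) {V : Set (AttachedSpace D)} (hV : V ∈ 𝓝 q) :
    ∃ W ∈ 𝓝 q, IsPreconnected W ∧ W ⊆ V ∩ proj ⁻¹' {proj q} := by
  obtain ⟨x, hx⟩ := exists_fiberIncl_eq q
  generalize proj q = g at *
  subst hx
  obtain ⟨A, hAV, hA, hxA, hAc⟩ := locallyConnectedSpace_iff_subsets_isOpen_isConnected.1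
    (inferInstance : LocallyConnectedSpace (D g)) x (fiberIncl D g ⁻¹' V)
    ((continuous_fiberIncl g).continuousAt.preimage_mem_nhds hV)
  have hclosed : IsClosed (fiberIncl D g '' Aᶜ) :=
    (isClosedEmbedding_fiberIncl g).isClosedMap _ hA.isClosed_compl
  refine ⟨fiberIncl D g '' A, ?_, hAc.isPreconnected.image _
    (continuous_fiberIncl _).continuousOn, image_subset_iff.2 fun y hy => ⟨hAV hy, rfl⟩⟩
  refine Filter.mem_of_superset (((isOpen_fiber_diff g).sdiff hclosed).mem_nhds
    ⟨⟨rfl, hq⟩, fun ⟨y, hy, hyx⟩ => hy (fiberIncl_injective g hyx ▸ hxA)⟩) ?_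
  rintro p ⟨⟨hp, -⟩, hpA⟩
  obtain ⟨y, rfl⟩ := (range_fiberIncl g).symm ▸ hp
  refine ⟨y, ?_, rfl⟩
  by_contra hyA
  exact hpA ⟨y, hyA, rfl⟩

theorem locallyConnectedSpace_proj_preimage [T2Space G] {N : Set G} [LocallyConnectedSpace N] :
    LocallyConnectedSpace (proj (D := D) ⁻¹' N) := by
  rw [locallyConnectedSpace_iff_connected_subsets]
  rintro ⟨q, hq⟩ V hV
  rw [nhds_subtype_eq_comap] at hV
  obtain ⟨V', hV', hVV'⟩ := hV
  obtain ⟨W, hW, hWc, hWV⟩ : ∃ W ∈ 𝓝[proj ⁻¹' N] q, IsPreconnected W ∧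
      W ⊆ V' ∩ proj ⁻¹' N := by
    by_cases hqi : q = incl D (proj q)
    · have := exists_isPreconnected_of_incl (D := D) (N := N) (g := proj q) hq (hqi ▸ hV')
      rwa [← hqi] at this
    · obtain ⟨W, hW, hWc, hWV⟩ := exists_isPreconnected_of_ne_incl hqi hV'
      exact ⟨W, mem_nhdsWithin_of_mem_nhds hW, hWc, hWV.trans (inter_subset_inter_right _
        (preimage_mono (singleton_subset_iff.2 hq)))⟩
  refine ⟨Subtype.val ⁻¹' W, ?_, ?_, fun p hp => hVV' (hWV hp).1⟩
  · exact preimage_coe_mem_nhds_subtype.2 hW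
  · refine (IsInducing.subtypeVal (t := proj (D := D) ⁻¹' N)).isPreconnected_image.1 ?_
    rwa [Subtype.image_preimage_coe, inter_eq_right.2 (hWV.trans inter_subset_right)]

/-- A simple closed curve lies in the base or in an attached dendrite. -/
theorem subset_range_incl_or_fiberIncl [T2Space G] {S : Set (AttachedSpace D)}
    (hS : IsSimpleClosedCurve S) :
    S ⊆ range (incl D) ∨ ∃ g, S ⊆ range (fiberIncl D g) := by
  by_cases h : S ⊆ range (incl D)
  · exact Or.inl h
  obtain ⟨q, hqS, hq⟩ := not_subset.1 h
  right
  refine ⟨proj q, ?_⟩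
  -- Once its attaching point is removed, the fiber is clopen in what remains, and the punctured
  -- curve is connected.
  have hsub : S \ {incl D (proj q)} ⊆ proj ⁻¹' {proj q} \ {incl D (proj q)} := by
    refine (hS.isPreconnected_diff_singleton _).subset_left_of_subset_union
      (isOpen_fiber_diff _) ((isClosed_singleton (x := proj q)).preimage
        (continuous_proj (D := D))).isOpen_compl
      (disjoint_left.2 fun p hp hp' => hp' hp.1) (fun p ⟨_, hp⟩ => ?_)
      ⟨q, ⟨hqS, fun h => hq ⟨_, h.symm⟩⟩, rfl, fun h => hq ⟨_, h.symm⟩⟩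
    by_cases hpq : proj p = proj q
    · exact Or.inl ⟨hpq, hp⟩
    · exact Or.inr hpq
  rw [range_fiberIncl]
  intro p hp
  by_cases hpq : p = incl D (proj q)
  · rw [hpq]
    rfl
  · exact (hsub ⟨hp, hpq⟩).1

theorem subset_range_incl [T2Space G] {S : Set (AttachedSpace D)}
    (hS : IsSimpleClosedCurve S) : S ⊆ range (incl D) := by
  rcases subset_range_incl_or_fiberIncl hS with h | ⟨g, h⟩
  · exact h
  · exact ((D g).isDendrite.noCurve _
      (hS.preimage (isClosedEmbedding_fiberIncl g).isEmbedding h)).elim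

/-- Dendrite neighborhoods in the base pull back to dendrite neighborhoods in the attached space. -/
theorem isDendrite_proj_preimage [CompactSpace G] [TopologicalSpace.MetrizableSpace G]
    (hD : {g : G | Nontrivial (D g)}.Countable) {N : Set G} (hN : IsDendrite N) :
    IsDendrite (proj (D := D) ⁻¹' N) := by
  have := compactSpace (D := D)
  have := metrizableSpace hD
  have := hN.locallyConnected
  have hNc : IsClosed N := (isCompact_iff_compactSpace.2 hN.continuum.compact).isClosed
  have hNcon : IsConnected N := isConnected_iff_connectedSpace.2 hN.continuum.connected
  refine ⟨⟨isCompact_iff_compactSpace.1 (hNc.preimage continuous_proj).isCompact,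
    isConnected_iff_connectedSpace.1 ⟨?_, isPreconnected_proj_preimage hNcon.isPreconnected⟩,
    inferInstance⟩, locallyConnectedSpace_proj_preimage, fun S hS => ?_⟩
  · obtain ⟨g, hg⟩ := hNcon.nonempty
    exact ⟨incl D g, hg⟩
  · have hS' := hS.image IsEmbedding.subtypeVal
    have hS'' := hS'.preimage isEmbedding_incl (subset_range_incl hS')
    refine hN.noCurve _ (hS''.preimage IsEmbedding.subtypeVal ?_)
    rintro g ⟨q, hq, hqg⟩
    have h := q.2
    rw [hqg] at h
    exact ⟨⟨g, h⟩, rfl⟩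

theorem isLocalDendrite (hG : IsLocalDendrite G) (hD : {g : G | Nontrivial (D g)}.Countable) :
    IsLocalDendrite (AttachedSpace D) := by
  have := hG.continuum.compact
  have := hG.continuum.connected
  have := hG.continuum.metrizable
  refine ⟨⟨compactSpace, ?_, metrizableSpace hD⟩, fun q => ?_⟩
  · have h := isPreconnected_proj_preimage (D := D) (N := univ) isPreconnected_univ
    obtain ⟨g⟩ := (inferInstance : Nonempty G)
    exact connectedSpace_iff_univ.2 ⟨⟨incl D g, mem_univ _⟩, h⟩
  · obtain ⟨N, hN, hNd⟩ := hG.exists_nhds (proj q)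
    exact ⟨_, continuous_proj.continuousAt.preimage_mem_nhds hN, isDendrite_proj_preimage hD hNd⟩

/-- The `G`-dendrite obtained by attaching countably many nondegenerate pointed dendrites. -/
def gDendrite (hG : IsLocalDendrite G) (hD : {g : G | Nontrivial (D g)}.Countable) :
    GDendrite G where
  carrier := AttachedSpace D
  isLocalDendrite := isLocalDendrite hG hD
  incl := incl D
  isEmbedding := isEmbedding_incl
  coreSkeleton_subset := by
    have := hG.continuum.compact
    have := hG.continuum.connected
    have := hG.continuum.metrizable
    have := metrizableSpace hD
    exact fun q hq => hq.2 _ ⟨isCompact_iff_compactSpace.1 (isCompact_range continuous_incl),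
      isConnected_iff_connectedSpace.1 (isConnected_range continuous_incl), inferInstance⟩
      fun S hS => subset_range_incl hS

/-- The component of `q` stays in the fiber of `proj`, which is closed and so contains its limit
point in the base. -/
theorem eq_proj (hG : IsLocalDendrite G) (hD : {g : G | Nontrivial (D g)}.Countable)
    {r : gDendrite hG hD → G} (hr : (gDendrite hG hD).IsCanonicalRetraction r)
    (q : AttachedSpace D) : r q = proj q := by
  have := hG.continuum.metrizable
  by_cases hq : q ∈ range (incl D)
  · obtain ⟨g, rfl⟩ := hq
    exact hr.map_incl g
  have hcl : IsClosed (proj (D := D) ⁻¹' {proj q}) := isClosed_singleton.preimage continuous_proj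
  have hsub : (gDendrite hG hD).branch q ⊆ proj ⁻¹' {proj q} \ {incl D (proj q)} := by
    refine GDendrite.isPreconnected_branch.subset_left_of_subset_union
      (isOpen_fiber_diff _) hcl.isOpen_compl
      (disjoint_left.2 fun p hp hp' => hp' hp.1) (fun p hp => ?_)
      ⟨q, GDendrite.mem_branch hq, rfl, fun h => hq ⟨_, h.symm⟩⟩
    by_cases hpq : proj p = proj q
    · exact Or.inl ⟨hpq, fun h => GDendrite.branch_subset hp ⟨proj q, h.symm⟩⟩
    · exact Or.inr hpq
  exact closure_minimal (hsub.trans sdiff_subset) hcl (hr.incl_mem_closure_branch hq)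

end AttachedSpace

end Attaching

/-! ### Full faithfulness and the essential image. -/

namespace GDendrite

open Set

variable {G : Type u} [TopologicalSpace G] {r : ∀ X : GDendrite G, X → G}
  {hr : ∀ X : GDendrite G, X.IsCanonicalRetraction (r X)}
  {hD : ∀ (X : GDendrite G) (g : G), IsDendrite {x : X // r X x = g}}
  {hM : ∀ (X Y : GDendrite G) (f : X ⟶ Y) (x : X), r Y (Hom.toFun f x) = r X x}

theorem full_fiberFunctor [CompactSpace G] [T2Space G] : (fiberFunctor r hr hD hM).Full where
  map_surjective {X Y} φ := by
    let f : X → Y := fun x => (PointedDendrite.Hom.toFun (φ (r X x)) ⟨x, rfl⟩).1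
    -- This form fixes the fiber `g`, so that the varying index `r X x` does not obstruct comparing
    -- points.
    have hf : ∀ g (x : X) (hx : r X x = g),
        f x = (PointedDendrite.Hom.toFun (φ g) ⟨x, hx⟩).1 := by
      rintro _ x rfl
      rfl
    have hincl : ∀ g, f (X.incl g) = Y.incl g := fun g => by
      rw [hf g _ ((hr X).map_incl g)]
      exact congrArg Subtype.val (PointedDendrite.Hom.map_point (φ g))
    have hemb : IsEmbedding f := by
      refine (hr X).isEmbedding_of_fibers (hr Y) (fun g => ?_) (fun g x hx y hy hxy => ?_)
        (fun x => (PointedDendrite.Hom.toFun (φ (r X x)) ⟨x, rfl⟩).2) hincl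
      · rw [continuousOn_iff_continuous_domRestrict]
        have hc : Continuous fun x => (PointedDendrite.Hom.toFun (φ g) x).1 :=
          continuous_subtype_val.comp (PointedDendrite.Hom.isEmbedding (φ g)).continuous
        exact hc.congr fun x => (hf g x.1 x.2).symm
      · rw [hf g x hx, hf g y hy] at hxy
        exact congrArg Subtype.val
          ((PointedDendrite.Hom.isEmbedding (φ g)).injective (Subtype.ext hxy))
    refine ⟨⟨f, hemb, hincl⟩, ?_⟩
    funext g
    refine PointedDendrite.Hom.ext (funext fun x => Subtype.ext ?_)
    exact hf g x.1 x.2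

theorem faithful_fiberFunctor : (fiberFunctor r hr hD hM).Faithful where
  map_injective {X Y} f f' h := by
    refine Hom.ext (funext fun x => ?_)
    have h1 := congrArg PointedDendrite.Hom.toFun (congrFun h (r X x))
    exact congrArg Subtype.val (congrFun h1 ⟨x, rfl⟩)

theorem essImage_fiberFunctor_iff (hG : IsLocalDendrite G) {D : G → PointedDendrite.{u}} :
    (fiberFunctor r hr hD hM).essImage D ↔ {g : G | Nontrivial (D g)}.Countable := by
  have := hG.continuum.compact
  have := hG.continuum.metrizable
  constructor
  · rintro ⟨X, ⟨e⟩⟩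
    refine (hr X).countable_nontrivial_fiber.mono fun g (hg : Nontrivial (D g)) => ?_
    exact (PointedDendrite.Hom.isEmbedding (e.inv g)).injective.nontrivial
  · intro hc
    refine ⟨AttachedSpace.gDendrite hG hc, ⟨CategoryTheory.Pi.isoMk fun g => Iso.symm ?_⟩⟩
    -- The chosen retraction is `proj`, so its fiber over `g` is the image of `D g`, and a
    -- continuous bijection of compact Hausdorff spaces is a homeomorphism.
    have hproj := AttachedSpace.eq_proj hG hc (hr (AttachedSpace.gDendrite hG hc))
    let F : D g → (fiberFunctor r hr hD hM).obj (AttachedSpace.gDendrite hG hc) g :=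
      fun x => ⟨AttachedSpace.fiberIncl D g x, hproj _⟩
    have hF : Function.Bijective F := by
      refine ⟨fun x y hxy => AttachedSpace.fiberIncl_injective g (congrArg Subtype.val hxy), ?_⟩
      rintro ⟨q, hq⟩
      obtain ⟨x, hx⟩ := AttachedSpace.exists_fiberIncl_eq q
      obtain rfl : AttachedSpace.proj q = g := (hproj q).symm.trans hq
      exact ⟨x, Subtype.ext hx⟩
    have hFc : Continuous F := (AttachedSpace.continuous_fiberIncl g).subtype_mk _
    refine PointedDendrite.isoOfHomeomorph
      (hFc.homeoOfEquivCompactToT2 (f := Equiv.ofBijective F hF)) ?_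
    exact Subtype.ext (AttachedSpace.fiberIncl_point g)

end GDendrite

theorem theorem7 (G : Type u) [TopologicalSpace G] (hG : IsLocalDendrite G) :
    ∃ (r : ∀ X : GDendrite G, X → G) (hr : ∀ X : GDendrite G, X.IsCanonicalRetraction (r X))
      (hD : ∀ (X : GDendrite G) (g : G), IsDendrite {x : X // r X x = g})
      (hM : ∀ (X Y : GDendrite G) (f : X ⟶ Y) (x : X),
        r Y (GDendrite.Hom.toFun f x) = r X x),
      (GDendrite.fiberFunctor r hr hD hM).Full ∧
      (GDendrite.fiberFunctor r hr hD hM).Faithful ∧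
      ∀ D : G → PointedDendrite.{u},
        (GDendrite.fiberFunctor r hr hD hM).essImage D ↔
          {g : G | Nontrivial (D g)}.Countable := by
  have := hG.continuum.compact
  have := hG.continuum.metrizable
  choose r hr using fun X : GDendrite G => GDendrite.exists_isCanonicalRetraction hG X
  exact ⟨r, hr, fun X g => (hr X).isDendrite_fiber g,
    fun X Y f x => (hr X).comp_hom (hr Y) f x, GDendrite.full_fiberFunctor,
    GDendrite.faithful_fiberFunctor, fun D => GDendrite.essImage_fiberFunctor_iff hG⟩
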